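/- Let $r\colon\mathbb R\to\mathbb R$ be a smooth function with $r>0$ on $(0,1)$, $r(0)=r(1)=0$ and $|r'(0)|,|r'(1)|<\frac1{2\pi}$. Let $\Sigma$ be the surface of revolution in $\mathbb R^3$ parametrized by $$X\colon(0,1)\times\mathbb R\to\mathbb R^3,\qquad (x,\phi)\mapsto(x,\,r(x)\cos\phi,\,r(x)\sin\phi),$$ and let $k=[1+(r'(x))^2]\,dx^2+r(x)^2\,d\phi^2$ be the Riemannian metric on $\Sigma$ induced by the Euclidean metric of $\mathbb R^3$. Denote by $\operatorname{dist}_k(p,q)$ the infimum of the $k$-lengths of $C^1$ curves in $\Sigma$ from $p$ to $q$. Consider the spacetime $(M,g)=(\mathbb R\times\Sigma,\,-dt^2+k)$, time-oriented by $\partial_t$. Let $J^+\subset M\times M$ be its causal relation, i.e. the set of pairs $(a,b)$ such that $a=b$ or there is a future-directed causal piecewise $C^1$ curve from $a$ to $b$. Then $(M,g)$ is causally simple, that is, there is no closed future-directed causal curve in $M$, and $J^+$ is a closed subset of $M\times M$. Moreover, for all $\sigma,\tau\in\mathbb R$ and $p,q\in\Sigma$, $$((\sigma,p),(\tau,q))\in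 J^+\iff \tau-\sigma\ge\operatorname{dist}_k(p,q).$$ -/

import Mathlib

open Bundle Set Manifold
open scoped ContDiff

noncomputable section

/-! ### Smooth fields of bilinear forms on a manifold -/

section Forms

variable {E : Type*} [NormedAddCommGroup E] [NormedSpace ℝ E] {H : Type*} [TopologicalSpace H]
  {I : ModelWithCorners ℝ E H} {M : Type*} [TopologicalSpace M] [ChartedSpace H M]
  {E' : Type*} [NormedAddCommGroup E'] [NormedSpace ℝ E'] {H' : Type*} [TopologicalSpace H']
  {J : ModelWithCorners ℝ E' H'} {N : Type*} [TopologicalSpace N] [ChartedSpace H' N]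

variable (I M) in
/-- A field of continuous bilinear forms on the tangent spaces of `M`. -/
abbrev FormField : Type _ := ∀ x : M, TangentSpace I x →L[ℝ] TangentSpace I x →L[ℝ] ℝ

/-- The field `B` is a smooth (`C^∞`) section of the bundle of bilinear forms. -/
def FormField.IsSmooth [IsManifold I ∞ M] (B : FormField I M) : Prop :=
  ContMDiff I (I.prod 𝓘(ℝ, E →L[ℝ] E →L[ℝ] ℝ)) ∞
    (fun x : M ↦ TotalSpace.mk' (E →L[ℝ] E →L[ℝ] ℝ)
      (E := fun x : M ↦ TangentSpace I x →L[ℝ] TangentSpace I x →L[ℝ] ℝ) x (B x))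

variable (I J) in
/-- The pullback `f^* B`, that is `(f^* B)_x (v, w) = B_{f x} (df v, df w)`. -/
def FormField.pullback (f : M → N) (B : FormField J N) : FormField I M := fun x ↦
  let b : E' →L[ℝ] E' →L[ℝ] ℝ := B (f x)
  let df : E →L[ℝ] E' := mfderiv I J f x
  (b.bilinearComp df df : E →L[ℝ] E →L[ℝ] ℝ)

theorem FormField.pullback_apply (f : M → N) (B : FormField J N) (x : M) (v w : TangentSpace I x) :
    FormField.pullback I J f B x v w = B (f x) (mfderiv I J f x v) (mfderiv I J f x w) := rfl

theorem FormField.IsSmooth.pullback [IsManifold I ∞ M] [IsManifold J ∞ N] {f : M → N}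
    {B : FormField J N} (hB : B.IsSmooth) (hf : ContMDiff I J ∞ f) :
    (FormField.pullback I J f B).IsSmooth := by
  intro x₀
  refine (contMDiffAt_hom_bundle _).2 ⟨contMDiffAt_id, ?_⟩
  have hA := (hf x₀).mfderiv_const (m := ∞) le_rfl
  have hB' := ((contMDiffAt_hom_bundle _).1 (hB (f x₀))).2.comp x₀ (hf x₀)
  have key : ContMDiffAt I 𝓘(ℝ, E →L[ℝ] E →L[ℝ] ℝ) ∞ (fun x ↦
      ((ContinuousLinearMap.compL ℝ E E' ℝ).flip
        (inTangentCoordinates I J id f (mfderiv I J f) x₀ x)).comp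
      ((ContinuousLinearMap.inCoordinates E' (TangentSpace J) (E' →L[ℝ] ℝ)
        (fun y : N ↦ TangentSpace J y →L[ℝ] ℝ) (f x₀) (f x) (f x₀) (f x) (B (f x))).comp
        (inTangentCoordinates I J id f (mfderiv I J f) x₀ x))) x₀ := by
    refine ContMDiffAt.clm_comp ?_ (ContMDiffAt.clm_comp hB' hA)
    exact (ContinuousLinearMap.contDiff _).contMDiff.contMDiffAt.comp x₀ hA
  refine key.congr_of_eventuallyEq ?_
  have h1 : ∀ᶠ x in nhds x₀, x ∈ (trivializationAt E (TangentSpace I) x₀).baseSet :=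
    (trivializationAt E (TangentSpace I) x₀).open_baseSet.mem_nhds
      (FiberBundle.mem_baseSet_trivializationAt' x₀)
  have h2 : ∀ᶠ x in nhds x₀, f x ∈ (trivializationAt E' (TangentSpace J) (f x₀)).baseSet :=
    hf.continuous.continuousAt.preimage_mem_nhds
      ((trivializationAt E' (TangentSpace J) (f x₀)).open_baseSet.mem_nhds
      (FiberBundle.mem_baseSet_trivializationAt' (f x₀)))
  filter_upwards [h1, h2] with x hx hfx
  ext v w
  rw [inCoordinates_apply_eq₂ (by exact hx) (by exact hx) (by simp)]
  simp only [ContinuousLinearMap.comp_apply, ContinuousLinearMap.flip_apply,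
    ContinuousLinearMap.compL_apply]
  rw [inCoordinates_apply_eq₂ (by exact hfx) (by exact hfx) (by simp)]
  have hd : ∀ v : E, (trivializationAt E' (TangentSpace J) (f x₀)).symm (f x)
      (inTangentCoordinates I J id f (mfderiv I J f) x₀ x v) =
      mfderiv I J f x ((trivializationAt E (TangentSpace I) x₀).symm x v) := by
    intro v
    change (trivializationAt E' (TangentSpace J) (f x₀)).symm (f x)
      ((trivializationAt E' (TangentSpace J) (f x₀)).continuousLinearMapAt ℝ (f x)
        (mfderiv I J f x ((trivializationAt E (TangentSpace I) x₀).symmL ℝ x v))) = _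
    rw [← Trivialization.symmL_apply (R := ℝ) _ hfx, ← Trivialization.symmL_apply (R := ℝ) _ hx,
      Trivialization.symmL_continuousLinearMapAt _ hfx]
  rw [hd, hd]
  rfl

theorem FormField.IsSmooth.add [IsManifold I ∞ M] {B C : FormField I M} (hB : B.IsSmooth)
    (hC : C.IsSmooth) : FormField.IsSmooth (B + C) :=
  ContMDiff.add_section hB hC

theorem FormField.IsSmooth.neg [IsManifold I ∞ M] {B : FormField I M} (hB : B.IsSmooth) :
    FormField.IsSmooth (-B) :=
  ContMDiff.neg_section hB

/-- The Euclidean metric of an inner product space, as a field of forms. -/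
def euclideanForm (F : Type*) [NormedAddCommGroup F] [InnerProductSpace ℝ F] :
    FormField 𝓘(ℝ, F) F := (riemannianMetricVectorSpace F).inner

theorem euclideanForm_isSmooth (F : Type*) [NormedAddCommGroup F] [InnerProductSpace ℝ F] :
    (euclideanForm F).IsSmooth :=
  (riemannianMetricVectorSpace F).contMDiff.of_le le_top

end Forms

/-! ### Spacetimes and causality -/

section Causality

variable {E : Type*} [NormedAddCommGroup E] [NormedSpace ℝ E] {H : Type*} [TopologicalSpace H]

/-- A time-oriented Lorentzian metric on the manifold `M`: a smooth field `metric` of symmetric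
bilinear forms of signature `(-, +, …, +)`, with a continuous timelike vector field `timeField`
giving the time orientation. The signature is expressed by saying that `timeField` is timelike and
that `metric` is positive definite on the orthogonal complement of `timeField`. -/
structure Spacetime (I : ModelWithCorners ℝ E H) (M : Type*) [TopologicalSpace M]
    [ChartedSpace H M] [IsManifold I ∞ M] where
  metric : FormField I M
  isSmooth : metric.IsSmooth
  symm : ∀ (x : M) (v w : TangentSpace I x), metric x v w = metric x w v
  timeField : ∀ x : M, TangentSpace I x
  continuous_timeField : Continuous (fun x : M ↦ (⟨x, timeField x⟩ : TangentBundle I M))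
  timelike : ∀ x : M, metric x (timeField x) (timeField x) < 0
  pos : ∀ (x : M) (v : TangentSpace I x), v ≠ 0 → metric x (timeField x) v = 0 → 0 < metric x v v

namespace Spacetime

variable {I : ModelWithCorners ℝ E H} {M : Type*} [TopologicalSpace M]
  [ChartedSpace H M] [IsManifold I ∞ M] (S : Spacetime I M)

/-- A tangent vector is future-directed causal if it is nonzero, timelike or null, and in the same
half-cone as the time orientation. -/
def IsFutureCausal (x : M) (v : TangentSpace I x) : Prop :=
  v ≠ 0 ∧ S.metric x v v ≤ 0 ∧ S.metric x v (S.timeField x) < 0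

/-- `p` is joined to `q` by a future-directed causal `C^1` curve `γ : [a, b] → M`, `a < b`. -/
def JoinedByCausalArc (p q : M) : Prop :=
  ∃ (a b : ℝ) (γ : ℝ → M), a < b ∧ γ a = p ∧ γ b = q ∧
    ContMDiffOn 𝓘(ℝ, ℝ) I 1 γ (Icc a b) ∧
    ∀ t ∈ Icc a b, S.IsFutureCausal (γ t) (mfderivWithin 𝓘(ℝ, ℝ) I γ (Icc a b) t (1 : ℝ))

/-- `p` is joined to `q` by a future-directed causal piecewise `C^1` curve, i.e. by a nonempty finite
concatenation of future-directed causal `C^1` curves. -/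
def JoinedByCausalCurve (p q : M) : Prop := Relation.TransGen S.JoinedByCausalArc p q

/-- The causal relation `J^+`, as a subset of `M × M`. -/
def causalRelation : Set (M × M) := {x | x.1 = x.2 ∨ S.JoinedByCausalCurve x.1 x.2}

/-- A spacetime is causal if it contains no closed future-directed causal curve. -/
def IsCausal : Prop := ∀ p : M, ¬ S.JoinedByCausalCurve p p

/-- A spacetime is causally simple if it is causal and its causal relation is closed. -/
def IsCausallySimple : Prop := S.IsCausal ∧ IsClosed S.causalRelation

end Spacetime

end Causality

/-! ### The surface of revolution -/

section Surface

/-- The open interval `(0, 1)` as a manifold. -/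
abbrev UnitIoo : TopologicalSpace.Opens ℝ := ⟨Ioo 0 1, isOpen_Ioo⟩

/-- The surface of revolution as an abstract smooth manifold `(0, 1) × S¹`: the point
`(x, exp (i φ))` stands for the point `(x, r x cos φ, r x sin φ)` of `ℝ³`. -/
abbrev RevSurface : Type := UnitIoo × Circle

/-- The model of the two-dimensional manifold `(0, 1) × S¹`. -/
abbrev revModel : ModelWithCorners ℝ (ℝ × EuclideanSpace ℝ (Fin 1))
    (ModelProd ℝ (EuclideanSpace ℝ (Fin 1))) := 𝓘(ℝ, ℝ).prod (𝓡 1)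

/-- The embedding of the surface of revolution with profile `r` into `ℝ³`. -/
def revEmbedding (r : ℝ → ℝ) (p : RevSurface) : EuclideanSpace ℝ (Fin 3) :=
  !₂[(p.1 : ℝ), r p.1 * (p.2 : ℂ).re, r p.1 * (p.2 : ℂ).im]

theorem revEmbedding_exp (r : ℝ → ℝ) (x : UnitIoo) (φ : ℝ) :
    revEmbedding r (x, Circle.exp φ) = !₂[(x : ℝ), r x * Real.cos φ, r x * Real.sin φ] := by
  simp [revEmbedding, Circle.coe_exp, Complex.exp_ofReal_mul_I_re, Complex.exp_ofReal_mul_I_im]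

theorem revEmbedding_injective (r : ℝ → ℝ) (hpos : ∀ x ∈ Ioo (0 : ℝ) 1, 0 < r x) :
    Function.Injective (revEmbedding r) := by
  rintro ⟨x, z⟩ ⟨y, w⟩ h
  have h0 := congrArg (fun v : EuclideanSpace ℝ (Fin 3) ↦ v 0) h
  have h1 := congrArg (fun v : EuclideanSpace ℝ (Fin 3) ↦ v 1) h
  have h2 := congrArg (fun v : EuclideanSpace ℝ (Fin 3) ↦ v 2) h
  simp [revEmbedding] at h0 h1 h2
  obtain rfl : x = y := h0
  have hx : r x ≠ 0 := (hpos x x.2).ne'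
  have : z = w := Circle.ext (Complex.ext (by simpa [hx] using h1) (by simpa [hx] using h2))
  rw [this]

/-- The coordinates `(x, exp (i φ))`, as a map to `ℝ × ℂ`. -/
def revCoord : RevSurface → ℝ × ℂ := Prod.map Subtype.val (fun z : Circle ↦ (z : ℂ))

theorem contMDiff_circle_coe : ContMDiff (𝓡 1) 𝓘(ℝ, ℂ) ∞ (fun z : Circle ↦ (z : ℂ)) :=
  haveI : Fact (Module.finrank ℝ ℂ = 1 + 1) := finrank_real_complex_fact'
  contMDiff_coe_sphere (E := ℂ) (n := 1)

theorem contMDiff_revCoord : ContMDiff revModel 𝓘(ℝ, ℝ × ℂ) ∞ revCoord := by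
  rw [modelWithCornersSelf_prod, ← chartedSpaceSelf_prod]
  exact contMDiff_subtype_val.prodMap contMDiff_circle_coe

theorem mfderiv_revCoord_injective (p : RevSurface) :
    Function.Injective (mfderiv revModel 𝓘(ℝ, ℝ × ℂ) revCoord p) := by
  have h1 : Function.Injective
      (mfderiv 𝓘(ℝ, ℝ) 𝓘(ℝ, ℝ) (Subtype.val : UnitIoo → ℝ) p.1) := by
    let g : ℝ → UnitIoo := fun y ↦ if h : y ∈ Ioo (0 : ℝ) 1 then ⟨y, h⟩ else p.1
    have hg : ContMDiffAt 𝓘(ℝ, ℝ) 𝓘(ℝ, ℝ) ∞ g (p.1 : ℝ) := by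
      rw [← ContMDiffAt.subtypeVal_comp_iff]
      refine contMDiffAt_id.congr_of_eventuallyEq ?_
      filter_upwards [isOpen_Ioo.mem_nhds p.1.2] with y hy
      simp only [Function.comp_apply, g, dif_pos hy, id]
    have hval := (contMDiff_subtype_val (n := 1) (I := 𝓘(ℝ, ℝ)) (U := UnitIoo)).mdifferentiableAt
      (x := p.1) one_ne_zero
    have hcomp := mfderiv_comp p.1 (hg.mdifferentiableAt (by simp)) hval
    have hid : g ∘ (Subtype.val : UnitIoo → ℝ) = id := by
      funext y
      exact dif_pos y.2
    rw [hid, mfderiv_id] at hcomp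
    intro v w hvw
    have hv := congrArg (fun L ↦ L v) hcomp
    have hw := congrArg (fun L ↦ L w) hcomp
    exact (hv.trans (congrArg (mfderiv 𝓘(ℝ, ℝ) 𝓘(ℝ, ℝ) g (p.1 : ℝ)) hvw)).trans hw.symm
  have h2 : Function.Injective
      (mfderiv (𝓡 1) 𝓘(ℝ, ℂ) (fun z : Circle ↦ (z : ℂ)) p.2) := by
    have : Fact (Module.finrank ℝ ℂ = 1 + 1) := finrank_real_complex_fact'
    exact injective_mvfderiv_subtypeVal_sphere (E := ℂ) (n := 1) p.2
  rw [modelWithCornersSelf_prod, ← chartedSpaceSelf_prod]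
  have := mfderiv_prodMap (p := p)
    ((contMDiff_subtype_val (n := ∞) (I := 𝓘(ℝ, ℝ)) (U := UnitIoo)).mdifferentiableAt (x := p.1) (by simp))
    (contMDiff_circle_coe.mdifferentiableAt (x := p.2) (by simp))
  unfold revCoord
  rw [this]
  exact h1.prodMap h2

theorem contMDiff_revEmbedding (r : ℝ → ℝ) (hr : ContDiff ℝ ∞ r) :
    ContMDiff revModel 𝓘(ℝ, EuclideanSpace ℝ (Fin 3)) ∞ (revEmbedding r) := by
  have hG : ContDiff ℝ ∞ (fun y : ℝ × ℂ ↦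
      (!₂[y.1, r y.1 * y.2.re, r y.1 * y.2.im] : EuclideanSpace ℝ (Fin 3))) := by
    have hre : ContDiff ℝ ∞ (fun y : ℝ × ℂ ↦ y.2.re) := Complex.reCLM.contDiff.comp contDiff_snd
    have him : ContDiff ℝ ∞ (fun y : ℝ × ℂ ↦ y.2.im) := Complex.imCLM.contDiff.comp contDiff_snd
    have hr1 : ContDiff ℝ ∞ (fun y : ℝ × ℂ ↦ r y.1) := hr.comp contDiff_fst
    rw [contDiff_euclidean]
    intro i
    fin_cases i
    · exact contDiff_fst
    · exact hr1.mul hre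
    · exact hr1.mul him
  exact hG.contMDiff.comp contMDiff_revCoord

theorem mfderiv_revEmbedding_injective (r : ℝ → ℝ) (hr : ContDiff ℝ ∞ r)
    (hpos : ∀ x ∈ Ioo (0 : ℝ) 1, 0 < r x) (p : RevSurface) :
    Function.Injective (mfderiv revModel 𝓘(ℝ, EuclideanSpace ℝ (Fin 3)) (revEmbedding r) p) := by
  let K : EuclideanSpace ℝ (Fin 3) → ℝ × ℂ := fun y ↦
    (y 0, (r (y 0))⁻¹ • ((y 1 : ℂ) + (y 2 : ℂ) * Complex.I))
  have hp : r (revEmbedding r p 0) ≠ 0 := (hpos _ p.1.2).ne'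
  have hK : DifferentiableAt ℝ K (revEmbedding r p) := by
    have hc : ∀ i : Fin 3, DifferentiableAt ℝ (fun y : EuclideanSpace ℝ (Fin 3) ↦ y i)
        (revEmbedding r p) := fun i ↦
      (EuclideanSpace.proj i : EuclideanSpace ℝ (Fin 3) →L[ℝ] ℝ).differentiableAt
    have hcc : ∀ i : Fin 3, DifferentiableAt ℝ (fun y : EuclideanSpace ℝ (Fin 3) ↦ (y i : ℂ))
        (revEmbedding r p) := fun i ↦ Complex.ofRealCLM.differentiableAt.comp _ (hc i)
    have hr0 : DifferentiableAt ℝ (fun y : EuclideanSpace ℝ (Fin 3) ↦ r (y 0))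
        (revEmbedding r p) :=
      ((hr.differentiable (by simp)).differentiableAt).comp (revEmbedding r p) (hc 0)
    exact (hc 0).prodMk ((hr0.inv hp).smul ((hcc 1).add ((hcc 2).mul_const _)))
  have hid : K ∘ revEmbedding r = revCoord := by
    funext q
    have hq : r q.1 ≠ 0 := (hpos _ q.1.2).ne'
    refine Prod.ext rfl (Complex.ext ?_ ?_) <;> simp [K, revEmbedding, revCoord, hq]
  have hcomp := mfderiv_comp p hK.mdifferentiableAt
    ((contMDiff_revEmbedding r hr).mdifferentiableAt (x := p) (by simp))
  rw [hid] at hcomp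
  intro v w hvw
  apply mfderiv_revCoord_injective p
  rw [hcomp]
  exact congrArg (mfderiv 𝓘(ℝ, EuclideanSpace ℝ (Fin 3)) 𝓘(ℝ, ℝ × ℂ) K (revEmbedding r p)) hvw

/-- The Riemannian metric `k` on the surface of revolution, i.e. the metric induced by the Euclidean
metric of `ℝ³`. In the coordinates `(x, φ)` it is `(1 + r'(x)^2) dx^2 + r(x)^2 dφ^2`. -/
def revMetric (r : ℝ → ℝ) (hr : ContDiff ℝ ∞ r) (hpos : ∀ x ∈ Ioo (0 : ℝ) 1, 0 < r x) :
    ContMDiffRiemannianMetric revModel ∞ (ℝ × EuclideanSpace ℝ (Fin 1))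
      (fun p : RevSurface ↦ TangentSpace revModel p) where
  inner := FormField.pullback revModel 𝓘(ℝ, EuclideanSpace ℝ (Fin 3)) (revEmbedding r)
    (euclideanForm (EuclideanSpace ℝ (Fin 3)))
  symm p v w := (riemannianMetricVectorSpace (EuclideanSpace ℝ (Fin 3))).symm
    (revEmbedding r p) _ _
  pos p v hv := by
    have hne : mfderiv revModel 𝓘(ℝ, EuclideanSpace ℝ (Fin 3)) (revEmbedding r) p v ≠ 0 := by
      intro h
      apply hv
      apply mfderiv_revEmbedding_injective r hr hpos p
      rw [map_zero]
      exact h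
    exact (riemannianMetricVectorSpace (EuclideanSpace ℝ (Fin 3))).pos _ _ hne
  isVonNBounded p := by
    let A : (ℝ × EuclideanSpace ℝ (Fin 1)) →L[ℝ] EuclideanSpace ℝ (Fin 3) :=
      mfderiv revModel 𝓘(ℝ, EuclideanSpace ℝ (Fin 3)) (revEmbedding r) p
    have hA : Function.Injective A := mfderiv_revEmbedding_injective r hr hpos p
    obtain ⟨K, -, hK⟩ := A.toLinearMap.exists_antilipschitzWith
      (LinearMap.ker_eq_bot.2 hA)
    change Bornology.IsVonNBounded ℝ
      {v : ℝ × EuclideanSpace ℝ (Fin 1) | inner ℝ (A v) (A v) < 1}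
    refine (NormedSpace.isVonNBounded_closedBall ℝ (ℝ × EuclideanSpace ℝ (Fin 1)) K).subset ?_
    intro v hv
    have h1 : ‖A v‖ < 1 := by
      have : inner ℝ (A v) (A v) < 1 := hv
      rw [real_inner_self_eq_norm_sq] at this
      nlinarith [norm_nonneg (A v)]
    have h2 := hK.le_mul_dist v 0
    have h3 : ‖v‖ ≤ K * ‖A v‖ := by simpa [dist_zero_right] using h2
    rw [mem_closedBall_zero_iff]
    nlinarith [K.coe_nonneg]
  contMDiff := (euclideanForm_isSmooth _).pullback (contMDiff_revEmbedding r hr)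

/-- The distance `dist_k` on the surface of revolution: the infimum of the `k`-lengths of the `C^1`
curves from `p` to `q`. -/
def revEDist (r : ℝ → ℝ) (hr : ContDiff ℝ ∞ r) (hpos : ∀ x ∈ Ioo (0 : ℝ) 1, 0 < r x)
    (p q : RevSurface) : ENNReal :=
  letI : RiemannianBundle (fun p : RevSurface ↦ TangentSpace revModel p) :=
    ⟨(revMetric r hr hpos).toRiemannianMetric⟩
  riemannianEDist revModel p q

/-- The model of the three-dimensional manifold `ℝ × Σ`. -/
abbrev staticModel : ModelWithCorners ℝ (ℝ × (ℝ × EuclideanSpace ℝ (Fin 1)))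
    (ModelProd ℝ (ModelProd ℝ (EuclideanSpace ℝ (Fin 1)))) := 𝓘(ℝ, ℝ).prod revModel

/-- The Lorentzian metric `-dt^2 + k` on `ℝ × Σ`: minus the pullback of the standard metric of `ℝ`
plus the pullback of `k`. -/
def staticMetric (r : ℝ → ℝ) (hr : ContDiff ℝ ∞ r) (hpos : ∀ x ∈ Ioo (0 : ℝ) 1, 0 < r x) :
    FormField staticModel (ℝ × RevSurface) :=
  -FormField.pullback staticModel 𝓘(ℝ, ℝ) Prod.fst (euclideanForm ℝ) +
    FormField.pullback staticModel revModel Prod.snd (revMetric r hr hpos).inner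

theorem staticMetric_apply (r : ℝ → ℝ) (hr : ContDiff ℝ ∞ r)
    (hpos : ∀ x ∈ Ioo (0 : ℝ) 1, 0 < r x) (x : ℝ × RevSurface)
    (v w : ℝ × (ℝ × EuclideanSpace ℝ (Fin 1))) :
    staticMetric r hr hpos x v w = -(v.1 * w.1) + (revMetric r hr hpos).inner x.2 v.2 w.2 := by
  have h : staticMetric r hr hpos x v w =
      -(euclideanForm ℝ x.1 (mfderiv staticModel 𝓘(ℝ, ℝ) Prod.fst x v)
        (mfderiv staticModel 𝓘(ℝ, ℝ) Prod.fst x w)) +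
      (revMetric r hr hpos).inner x.2 (mfderiv staticModel revModel Prod.snd x v)
        (mfderiv staticModel revModel Prod.snd x w) := rfl
  rw [h, mfderiv_fst, mfderiv_snd]
  congr 2
  exact mul_comm _ _

/-- The spacetime `(ℝ × Σ, -dt^2 + k)`, time-oriented by `∂_t`. -/
def staticSpacetime (r : ℝ → ℝ) (hr : ContDiff ℝ ∞ r) (hpos : ∀ x ∈ Ioo (0 : ℝ) 1, 0 < r x) :
    Spacetime staticModel (ℝ × RevSurface) where
  metric := staticMetric r hr hpos
  isSmooth := ((euclideanForm_isSmooth ℝ).pullback contMDiff_fst).neg.add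
    (FormField.IsSmooth.pullback (revMetric r hr hpos).contMDiff contMDiff_snd)
  symm x v w := by
    refine (staticMetric_apply r hr hpos x v w).trans
      (Eq.trans ?_ (staticMetric_apply r hr hpos x w v).symm)
    exact congrArg₂ (fun a b : ℝ ↦ -a + b) (mul_comm _ _) ((revMetric r hr hpos).symm x.2 _ _)
  timeField x := ((1 : ℝ), (0 : ℝ × EuclideanSpace ℝ (Fin 1)))
  continuous_timeField := by
    have h := contMDiff_equivTangentBundleProd_symm (n := 0) (I := 𝓘(ℝ, ℝ)) (I' := revModel)
      (M := ℝ) (M' := RevSurface)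
    have h1 : Continuous (fun x : ℝ ↦ (⟨x, (1 : ℝ)⟩ : TangentBundle 𝓘(ℝ, ℝ) ℝ)) := by
      exact (tangentBundleModelSpaceHomeomorph 𝓘(ℝ, ℝ)).symm.continuous.comp
        (continuous_id.prodMk continuous_const)
    have h2 : Continuous (fun x : RevSurface ↦ (⟨x, 0⟩ : TangentBundle revModel RevSurface)) :=
      (Bundle.contMDiff_zeroSection (n := 0) (IB := revModel) ℝ
        (TangentSpace revModel : RevSurface → Type _)).continuous
    exact h.continuous.comp ((h1.comp continuous_fst).prodMk (h2.comp continuous_snd))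
  timelike x := by
    refine (staticMetric_apply r hr hpos x (1, 0) (1, 0)).trans_lt ?_
    have h0 : (revMetric r hr hpos).inner x.2 0 0 = 0 := map_zero _
    change -((1 : ℝ) * 1) + (revMetric r hr hpos).inner x.2 0 0 < 0
    rw [h0]
    norm_num
  pos x v hv h := by
    obtain ⟨a, u⟩ := (v : ℝ × (ℝ × EuclideanSpace ℝ (Fin 1)))
    have h' := (staticMetric_apply r hr hpos x (1, 0) (a, u)).symm.trans h
    have h0 : (revMetric r hr hpos).inner x.2 0 = 0 := map_zero _
    have ha : a = 0 := by
      have h1 : (revMetric r hr hpos).inner x.2 0 u = 0 := congrArg (fun L ↦ L u) h0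
      change -((1 : ℝ) * a) + (revMetric r hr hpos).inner x.2 0 u = 0 at h'
      rw [h1] at h'
      linarith
    subst ha
    have hu : u ≠ 0 := fun hu ↦ hv (by rw [hu]; rfl)
    refine lt_of_lt_of_eq ?_ (staticMetric_apply r hr hpos x (0, u) (0, u)).symm
    change 0 < -((0 : ℝ) * 0) + (revMetric r hr hpos).inner x.2 u u
    have := (revMetric r hr hpos).pos x.2 u hu
    linarith

end Surface

end

/-! Write `D` for the distance of `p` and `q` on the surface. A future-directed causal vector has
positive time component at least as large as the length of its spatial part. Integrating along a
causal curve, the time strictly increases, which excludes closed causal curves, and it increases by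
at least the distance of the projected endpoints (`revDist_le_of_joinedByCausalCurve`). Conversely,
a `C^1` curve on `[0, 1]` from `p` to `q` of speed at most `D`, paired with an affine time
coordinate, is causal as soon as `0 < τ - σ` and `D ≤ τ - σ`. So everything rests on minimizing
curves (`exists_minimizing_curve`); once `J^+` is known to be `D ≤ τ - σ`, it is closed because the
distance is continuous.

The surface is incomplete at its two tips, and this is where the slope condition enters. Since `2π
|r'(0)| < 1`, there are arbitrarily small `l` for which the latitude circle at `x = l` is shorter
than `l`. A curve that starts and ends above `l` but dips below `l / 2` spends more than `l` between
two visits to that circle, and following the circle instead saves a definite amount. Almost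
minimizing curves therefore stay in a compact band (`exists_confinement`).

In that band the direct method applies to the energy `∫ a(x) x'² + b(x) φ'²`, with `a = 1 + r'²` and
`b = r²`. A uniform limit of a minimizing sequence is a priori only Lipschitz, whereas causal curves
must be piecewise `C^1`. Regularity is obtained before passing to the limit: comparing an almost
minimizer with explicit competitors shows that `b(x) φ'` and `2 a(x) x' - ∫ (a'(x) x'² + b'(x) φ'²)`
are `L²`-close to constants (`exists_almost_eulerLagrange`). Along a subsequence the curves converge
uniformly by Arzelà-Ascoli and these errors vanish almost everywhere, so the velocities converge
almost everywhere to continuous functions; the limit is `C^1` with speed at most `D`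
(`exists_limit_curve`). -/

noncomputable section

open MeasureTheory Filter Topology

/-! ### Riemannian distance and lengths of curves in the coordinates `(x, φ)`. -/

section Bridge

variable (r : ℝ → ℝ) (hr : ContDiff ℝ ∞ r) (hpos : ∀ x ∈ Ioo (0 : ℝ) 1, 0 < r x)

theorem revEDist_triangle (p q s : RevSurface) :
    revEDist r hr hpos p s ≤ revEDist r hr hpos p q + revEDist r hr hpos q s := by
  let _ : RiemannianBundle (fun p : RevSurface ↦ TangentSpace revModel p) :=
    ⟨(revMetric r hr hpos).toRiemannianMetric⟩
  exact riemannianEDist_triangle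

theorem revEDist_comm (p q : RevSurface) :
    revEDist r hr hpos p q = revEDist r hr hpos q p := by
  let _ : RiemannianBundle (fun p : RevSurface ↦ TangentSpace revModel p) :=
    ⟨(revMetric r hr hpos).toRiemannianMetric⟩
  exact riemannianEDist_comm

theorem revEDist_self (p : RevSurface) : revEDist r hr hpos p p = 0 := by
  let _ : RiemannianBundle (fun p : RevSurface ↦ TangentSpace revModel p) :=
    ⟨(revMetric r hr hpos).toRiemannianMetric⟩
  exact riemannianEDist_self

theorem eventually_revEDist_lt (p : RevSurface) {c : ENNReal} (hc : 0 < c) :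
    ∀ᶠ q in 𝓝 p, revEDist r hr hpos p q < c := by
  let _ : RiemannianBundle (fun p : RevSurface ↦ TangentSpace revModel p) :=
    ⟨(revMetric r hr hpos).toRiemannianMetric⟩
  have : IsContMDiffRiemannianBundle revModel ∞ (ℝ × EuclideanSpace ℝ (Fin 1))
      (fun p : RevSurface ↦ TangentSpace revModel p) :=
    ⟨(revMetric r hr hpos).inner, (revMetric r hr hpos).contMDiff, fun _ _ _ ↦ rfl⟩
  have : IsContinuousRiemannianBundle (ℝ × EuclideanSpace ℝ (Fin 1))
      (fun p : RevSurface ↦ TangentSpace revModel p) :=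
    ⟨(revMetric r hr hpos).inner, (revMetric r hr hpos).contMDiff.continuous, fun _ _ _ ↦ rfl⟩
  exact eventually_riemannianEDist_lt revModel p hc

/-- Allowing any majorant `g` of the speed serves two purposes: `g` is the coordinate speed of a
curve on the surface, or the time derivative along a causal curve. -/
theorem revEDist_le_ofReal_integral {γ : ℝ → RevSurface} {a b : ℝ} (hab : a ≤ b)
    (hγ : ContMDiffOn 𝓘(ℝ, ℝ) revModel 1 γ (Icc a b)) {g : ℝ → ℝ} (hg : ContinuousOn g (Icc a b))
    (hg0 : ∀ t ∈ Icc a b, 0 ≤ g t)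
    (h : ∀ t ∈ Icc a b, (revMetric r hr hpos).inner (γ t)
      (mfderivWithin 𝓘(ℝ, ℝ) revModel γ (Icc a b) t (1 : ℝ))
      (mfderivWithin 𝓘(ℝ, ℝ) revModel γ (Icc a b) t (1 : ℝ)) ≤ g t ^ 2) :
    revEDist r hr hpos (γ a) (γ b) ≤ ENNReal.ofReal (∫ t in a..b, g t) := by
  let _ : RiemannianBundle (fun p : RevSurface ↦ TangentSpace revModel p) :=
    ⟨(revMetric r hr hpos).toRiemannianMetric⟩
  refine (riemannianEDist_le_pathELength hγ rfl rfl hab).trans ?_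
  rw [pathELength_eq_lintegral_mfderivWithin_Icc, intervalIntegral.integral_of_le hab,
    ← integral_Icc_eq_integral_Ioc, ofReal_integral_eq_lintegral_ofReal]
  · refine setLIntegral_mono' measurableSet_Icc fun t ht ↦ ?_
    rw [← ofReal_norm]
    refine ENNReal.ofReal_le_ofReal ?_
    rw [norm_eq_sqrt_real_inner]
    exact Real.sqrt_le_iff.2 ⟨hg0 t ht, h t ht⟩
  · exact hg.integrableOn_Icc
  · filter_upwards [self_mem_ae_restrict measurableSet_Icc] with t ht using hg0 t ht

/-- An almost minimizing curve can be chosen locally constant near its endpoints, hence `C^1` on all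
of `ℝ`; this allows ordinary derivatives from here on. -/
theorem exists_curve_of_revEDist_lt {p q : RevSurface} {c : ENNReal}
    (h : revEDist r hr hpos p q < c) :
    ∃ γ : ℝ → RevSurface, γ 0 = p ∧ γ 1 = q ∧ ContMDiff 𝓘(ℝ, ℝ) revModel 1 γ ∧
      ∫⁻ t in Icc (0 : ℝ) 1, ENNReal.ofReal (√((revMetric r hr hpos).inner (γ t)
        (mfderiv 𝓘(ℝ, ℝ) revModel γ t (1 : ℝ)) (mfderiv 𝓘(ℝ, ℝ) revModel γ t (1 : ℝ)))) < c := by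
  let _ : RiemannianBundle (fun p : RevSurface ↦ TangentSpace revModel p) :=
    ⟨(revMetric r hr hpos).toRiemannianMetric⟩
  obtain ⟨γ, h0, h1, hγ, hl, -⟩ :=
    exists_lt_locally_constant_of_riemannianEDist_lt (I := revModel) h zero_lt_one
  refine ⟨γ, h0, h1, hγ, lt_of_eq_of_lt ?_ hl⟩
  rw [pathELength_eq_lintegral_mfderiv_Icc]
  refine setLIntegral_congr_fun measurableSet_Icc fun t ht ↦ ?_
  rw [← ofReal_norm, norm_eq_sqrt_real_inner]
  rfl

/-- The squared length `(1 + r'(y)²) w² + r(y)² z²` of the tangent vector `w ∂_x + z ∂_φ` at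
a point with first coordinate `y`. -/
def revSpeedSq (y w z : ℝ) : ℝ := (1 + deriv r y ^ 2) * w ^ 2 + r y ^ 2 * z ^ 2

theorem revSpeedSq_nonneg (y w z : ℝ) : 0 ≤ revSpeedSq r y w z := by
  unfold revSpeedSq; positivity

theorem sq_le_revSpeedSq (y w z : ℝ) : w ^ 2 ≤ revSpeedSq r y w z := by
  unfold revSpeedSq
  nlinarith [mul_nonneg (sq_nonneg (deriv r y)) (sq_nonneg w), mul_nonneg (sq_nonneg (r y)) (sq_nonneg z)]

/-- The metric is a pullback from `ℝ³`, so the chain rule reduces the claim to differentiating `(x,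
r(x) cos φ, r(x) sin φ)`; the mixed terms cancel and `sin² + cos² = 1` does the rest. -/
theorem revMetric_inner_mfderivWithin {γ : ℝ → RevSurface} {s : Set ℝ} {t : ℝ} (ht : t ∈ s)
    (hs : UniqueDiffWithinAt ℝ s t) (hγ : MDifferentiableWithinAt 𝓘(ℝ, ℝ) revModel γ s t)
    {x φ : ℝ → ℝ} {x' φ' : ℝ} (hx : HasDerivWithinAt x x' s t) (hφ : HasDerivWithinAt φ φ' s t)
    (h1 : ∀ u ∈ s, ((γ u).1 : ℝ) = x u) (h2 : ∀ u ∈ s, (γ u).2 = Circle.exp (φ u)) :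
    (revMetric r hr hpos).inner (γ t) (mfderivWithin 𝓘(ℝ, ℝ) revModel γ s t (1 : ℝ))
      (mfderivWithin 𝓘(ℝ, ℝ) revModel γ s t (1 : ℝ)) = revSpeedSq r (x t) x' φ' := by
  have hcomp := mfderiv_comp_mfderivWithin t
    ((contMDiff_revEmbedding r hr).mdifferentiableAt (x := γ t) (by simp)) hγ hs.uniqueMDiffWithinAt
  have hrd : HasDerivAt r (deriv r (x t)) (x t) :=
    ((hr.differentiable (by simp)) _).hasDerivAt
  have hrx := hrd.comp_hasDerivWithinAt t hx
  have hE : HasDerivWithinAt (revEmbedding r ∘ γ)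
      (!₂[x', deriv r (x t) * x' * Real.cos (φ t) + r (x t) * (-Real.sin (φ t) * φ'),
        deriv r (x t) * x' * Real.sin (φ t) + r (x t) * (Real.cos (φ t) * φ')] :
          EuclideanSpace ℝ (Fin 3)) s t := by
    have hE' : HasDerivWithinAt (fun u ↦ (!₂[x u, r (x u) * Real.cos (φ u),
        r (x u) * Real.sin (φ u)] : EuclideanSpace ℝ (Fin 3)))
      (!₂[x', deriv r (x t) * x' * Real.cos (φ t) + r (x t) * (-Real.sin (φ t) * φ'),
        deriv r (x t) * x' * Real.sin (φ t) + r (x t) * (Real.cos (φ t) * φ')] :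
          EuclideanSpace ℝ (Fin 3)) s t := by
      rw [hasDerivWithinAt_iff_hasFDerivWithinAt, hasFDerivWithinAt_euclidean]
      intro i
      fin_cases i
      · exact hx.hasFDerivWithinAt.congr_fderiv (ContinuousLinearMap.ext_ring (by simp))
      · exact (hrx.mul hφ.cos).hasFDerivWithinAt.congr_fderiv
          (ContinuousLinearMap.ext_ring (by simp))
      · exact (hrx.mul hφ.sin).hasFDerivWithinAt.congr_fderiv
          (ContinuousLinearMap.ext_ring (by simp))
    have hcongr : ∀ u ∈ s, (revEmbedding r ∘ γ) u = !₂[x u, r (x u) * Real.cos (φ u),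
        r (x u) * Real.sin (φ u)] := by
      intro u hu
      have : γ u = ((γ u).1, Circle.exp (φ u)) := Prod.ext rfl (h2 u hu)
      simp only [Function.comp_apply]
      rw [this, revEmbedding_exp, ← h1 u hu]
    exact hE'.congr hcongr (hcongr t ht)
  have hv : mfderiv revModel 𝓘(ℝ, EuclideanSpace ℝ (Fin 3)) (revEmbedding r) (γ t)
      (mfderivWithin 𝓘(ℝ, ℝ) revModel γ s t (1 : ℝ)) =
      (!₂[x', deriv r (x t) * x' * Real.cos (φ t) + r (x t) * (-Real.sin (φ t) * φ'),
        deriv r (x t) * x' * Real.sin (φ t) + r (x t) * (Real.cos (φ t) * φ')] :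
          EuclideanSpace ℝ (Fin 3)) := by
    have h3 := congrArg (fun L ↦ L (1 : ℝ)) hcomp
    refine Eq.trans h3.symm ?_
    rw [mfderivWithin_eq_fderivWithin]
    have := hE.hasFDerivWithinAt.fderivWithin hs
    rw [this]
    exact one_smul ℝ _
  have hin : ∀ v : EuclideanSpace ℝ (Fin 3),
      euclideanForm (EuclideanSpace ℝ (Fin 3)) (revEmbedding r (γ t)) v v =
        v 0 ^ 2 + v 1 ^ 2 + v 2 ^ 2 := by
    intro v
    change inner ℝ v v = _
    rw [real_inner_self_eq_norm_sq, EuclideanSpace.norm_sq_eq, Fin.sum_univ_three]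
    simp
  refine Eq.trans (FormField.pullback_apply _ _ _ _ _) ?_
  refine Eq.trans (congrArg₂ (fun v w ↦ euclideanForm (EuclideanSpace ℝ (Fin 3))
    (revEmbedding r (γ t)) v w) hv hv) ?_
  refine Eq.trans (hin _) ?_
  simp [revSpeedSq]
  linear_combination (deriv r (x t) ^ 2 * x' ^ 2 + r (x t) ^ 2 * φ' ^ 2) * Real.sin_sq_add_cos_sq (φ t)

/-- A real number in `(0, 1)` as a point of the manifold `(0, 1)`, with a junk value elsewhere. -/
def toUnitIoo (y : ℝ) : UnitIoo :=
  if h : y ∈ Ioo (0 : ℝ) 1 then ⟨y, h⟩ else ⟨1 / 2, by norm_num, by norm_num⟩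

theorem coe_toUnitIoo {y : ℝ} (h : y ∈ Ioo (0 : ℝ) 1) : (toUnitIoo y : ℝ) = y := by
  simp only [toUnitIoo, dif_pos h]

theorem toUnitIoo_coe (y : UnitIoo) : toUnitIoo y = y := Subtype.ext (coe_toUnitIoo y.2)

theorem contMDiffAt_toUnitIoo {y : ℝ} (h : y ∈ Ioo (0 : ℝ) 1) :
    ContMDiffAt 𝓘(ℝ, ℝ) 𝓘(ℝ, ℝ) ∞ toUnitIoo y := by
  rw [← ContMDiffAt.subtypeVal_comp_iff]
  refine contMDiffAt_id.congr_of_eventuallyEq ?_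
  filter_upwards [isOpen_Ioo.mem_nhds h] with z hz using coe_toUnitIoo hz

/-- The curve on the surface with coordinates `(x, φ)`. -/
def revCurve (x φ : ℝ → ℝ) (t : ℝ) : RevSurface := (toUnitIoo (x t), Circle.exp (φ t))

theorem contMDiffOn_revCurve {x φ : ℝ → ℝ} {s : Set ℝ} (hx : ContDiffOn ℝ 1 x s)
    (hφ : ContDiffOn ℝ 1 φ s) (h : ∀ t ∈ s, x t ∈ Ioo (0 : ℝ) 1) :
    ContMDiffOn 𝓘(ℝ, ℝ) revModel 1 (revCurve x φ) s := by
  have A : ContMDiffOn 𝓘(ℝ, ℝ) 𝓘(ℝ, ℝ) 1 (fun t ↦ toUnitIoo (x t)) s := fun t ht ↦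
    ((contMDiffAt_toUnitIoo (h t ht)).of_le (by simp)).comp_contMDiffWithinAt t
      (hx.contMDiffOn t ht)
  have B : ContMDiffOn 𝓘(ℝ, ℝ) (𝓡 1) 1 (fun t ↦ Circle.exp (φ t)) s :=
    contMDiff_circleExp.comp_contMDiffOn hφ.contMDiffOn
  exact A.prodMk B

theorem continuous_revSpeedSq {r : ℝ → ℝ} (hr : ContDiff ℝ ∞ r) :
    Continuous (fun y : ℝ × ℝ × ℝ ↦ revSpeedSq r y.1 y.2.1 y.2.2) := by
  have h1 : Continuous r := hr.continuous
  have h2 : Continuous (deriv r) := hr.continuous_deriv (by simp)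
  unfold revSpeedSq
  fun_prop

theorem revMetric_inner_revCurve {x φ : ℝ → ℝ} {s : Set ℝ} {t : ℝ} (ht : t ∈ s)
    (hs : UniqueDiffWithinAt ℝ s t) (hx : ContDiff ℝ 1 x) (hφ : ContDiff ℝ 1 φ)
    (h : ∀ t ∈ s, x t ∈ Ioo (0 : ℝ) 1) :
    (revMetric r hr hpos).inner (revCurve x φ t)
      (mfderivWithin 𝓘(ℝ, ℝ) revModel (revCurve x φ) s t (1 : ℝ))
      (mfderivWithin 𝓘(ℝ, ℝ) revModel (revCurve x φ) s t (1 : ℝ)) =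
      revSpeedSq r (x t) (deriv x t) (deriv φ t) :=
  revMetric_inner_mfderivWithin r hr hpos ht hs
    ((contMDiffOn_revCurve hx.contDiffOn hφ.contDiffOn h).mdifferentiableOn one_ne_zero t ht)
    ((hx.differentiable one_ne_zero) t).hasDerivAt.hasDerivWithinAt
    ((hφ.differentiable one_ne_zero) t).hasDerivAt.hasDerivWithinAt
    (fun u hu ↦ coe_toUnitIoo (h u hu)) (fun _ _ ↦ rfl)

theorem continuous_revSpeedSq_curve {r x φ : ℝ → ℝ} (hr : ContDiff ℝ ∞ r) (hx : ContDiff ℝ 1 x)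
    (hφ : ContDiff ℝ 1 φ) :
    Continuous (fun t ↦ revSpeedSq r (x t) (deriv x t) (deriv φ t)) :=
  (continuous_revSpeedSq hr).comp (hx.continuous.prodMk
    ((hx.continuous_deriv le_rfl).prodMk (hφ.continuous_deriv le_rfl)))

/-- The distance is at most the length of a `C^1` curve given in coordinates. -/
theorem revEDist_revCurve_le {x φ : ℝ → ℝ} {a b : ℝ} (hab : a ≤ b) (hx : ContDiff ℝ 1 x)
    (hφ : ContDiff ℝ 1 φ) (h : ∀ t ∈ Icc a b, x t ∈ Ioo (0 : ℝ) 1) :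
    revEDist r hr hpos (revCurve x φ a) (revCurve x φ b) ≤
      ENNReal.ofReal (∫ t in a..b, √(revSpeedSq r (x t) (deriv x t) (deriv φ t))) := by
  rcases hab.eq_or_lt with rfl | hab'
  · simp [revEDist_self]
  refine revEDist_le_ofReal_integral r hr hpos hab
    (contMDiffOn_revCurve hx.contDiffOn hφ.contDiffOn h)
    (continuous_revSpeedSq_curve hr hx hφ).sqrt.continuousOn (fun _ _ ↦ Real.sqrt_nonneg _)
    fun t ht ↦ ?_
  rw [Real.sq_sqrt (revSpeedSq_nonneg r _ _ _)]
  exact (revMetric_inner_revCurve r hr hpos ht (uniqueDiffOn_Icc hab' t ht) hx hφ h).le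

end Bridge

/-! ### Angle functions of curves. -/

section Lift

theorem contDiff_one_integral {f : ℝ → ℝ} (hf : Continuous f) (c : ℝ) :
    ContDiff ℝ 1 (fun t ↦ c + ∫ u in (0 : ℝ)..t, f u) := by
  have h : ∀ t, HasDerivAt (fun t ↦ c + ∫ u in (0 : ℝ)..t, f u) (f t) t := fun t ↦
    (hf.integral_hasStrictDerivAt 0 t).hasDerivAt.const_add c
  rw [contDiff_one_iff_deriv]
  refine ⟨fun t ↦ (h t).differentiableAt, ?_⟩
  rw [show deriv (fun t ↦ c + ∫ u in (0 : ℝ)..t, f u) = f from funext fun t ↦ (h t).deriv]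
  exact hf

theorem hasDerivAt_const_add_integral {f : ℝ → ℝ} (hf : Continuous f) (c t : ℝ) :
    HasDerivAt (fun t ↦ c + ∫ u in (0 : ℝ)..t, f u) (f t) t :=
  (hf.integral_hasStrictDerivAt 0 t).hasDerivAt.const_add c

/-- A `C^1` curve in the unit circle has a `C^1` angle function. -/
theorem exists_lift_circle {z : ℝ → Circle} (hz : ContDiff ℝ 1 (fun t ↦ (z t : ℂ))) {φ₀ : ℝ}
    (h0 : Circle.exp φ₀ = z 0) :
    ∃ φ : ℝ → ℝ, ContDiff ℝ 1 φ ∧ φ 0 = φ₀ ∧ ∀ t, z t = Circle.exp (φ t) := by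
  set Z : ℝ → ℂ := fun t ↦ (z t : ℂ) with hZ
  have hd : ∀ t, HasDerivAt Z (deriv Z t) t := fun t ↦
    ((hz.differentiable one_ne_zero) t).hasDerivAt
  have hn : ∀ t, starRingEnd ℂ (Z t) * Z t = 1 := fun t ↦ by
    rw [mul_comm, Complex.mul_conj, Circle.normSq_coe]; simp
  have hω : Continuous fun t ↦ (starRingEnd ℂ (Z t) * deriv Z t).im :=
    Complex.continuous_im.comp ((Complex.continuous_conj.comp hz.continuous).mul
      (hz.continuous_deriv le_rfl))
  have hconj : ∀ t, HasDerivAt (fun t ↦ starRingEnd ℂ (Z t)) (starRingEnd ℂ (deriv Z t)) t :=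
    fun t ↦ (Complex.conjCLE : ℂ →L[ℝ] ℂ).hasFDerivAt.comp_hasDerivAt t (hd t)
  -- Differentiating `|Z|² = 1` shows that `conj Z * Z'` is purely imaginary; its imaginary part is
  -- the angular velocity.
  have hre : ∀ t, (starRingEnd ℂ (Z t) * deriv Z t).re = 0 := fun t ↦ by
    have h1 := (hconj t).mul (hd t)
    have h2 : (fun t ↦ starRingEnd ℂ (Z t)) * Z = fun _ ↦ 1 := funext hn
    rw [h2] at h1
    have h3 := congrArg Complex.re (h1.unique (hasDerivAt_const t (1 : ℂ)))
    simp at h3 ⊢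
    linarith
  refine ⟨fun t ↦ φ₀ + ∫ u in (0 : ℝ)..t, (starRingEnd ℂ (Z u) * deriv Z u).im,
    contDiff_one_integral hω φ₀, by simp, fun t ↦ ?_⟩
  set φ : ℝ → ℝ := fun t ↦ φ₀ + ∫ u in (0 : ℝ)..t, (starRingEnd ℂ (Z u) * deriv Z u).im
  have hφ : ∀ t, HasDerivAt φ (starRingEnd ℂ (Z t) * deriv Z t).im t :=
    hasDerivAt_const_add_integral hω φ₀
  have hz' : ∀ t, deriv Z t = (starRingEnd ℂ (Z t) * deriv Z t).im * Complex.I * Z t := fun t ↦ by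
    have h1 : starRingEnd ℂ (Z t) * deriv Z t =
        (starRingEnd ℂ (Z t) * deriv Z t).im * Complex.I := by
      apply Complex.ext
      · rw [hre]; simp
      · simp
    rw [← h1]
    linear_combination (-deriv Z t) * hn t
  -- `Z e^{-iφ}` is constant, and equals `1` at time `0`.
  have hc : ∀ t, HasDerivAt (fun t ↦ Z t * Complex.exp (-(φ t * Complex.I))) 0 t := fun t ↦ by
    have h1 := (((hφ t).ofReal_comp.mul_const Complex.I).neg.cexp)
    have h2 := (hd t).mul h1
    refine h2.congr_deriv ?_
    have hzt := hz' t
    generalize (starRingEnd ℂ (Z t) * deriv Z t).im = w at hzt ⊢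
    rw [hzt]
    ring
  have hconst := is_const_of_deriv_eq_zero (fun t ↦ (hc t).differentiableAt)
    (fun t ↦ (hc t).deriv) t 0
  have hφ0 : φ 0 = φ₀ := by simp [φ]
  have hZ0 : Z 0 = Complex.exp (φ₀ * Complex.I) := by
    rw [← Circle.coe_exp, h0]
  simp only [hφ0] at hconst
  rw [hZ0, ← Complex.exp_add, add_neg_cancel, Complex.exp_zero] at hconst
  apply Circle.ext
  rw [Circle.coe_exp]
  have h5 : Complex.exp (-(φ t * Complex.I)) * Complex.exp (φ t * Complex.I) = 1 := by
    rw [← Complex.exp_add, neg_add_cancel, Complex.exp_zero]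
  change Z t = _
  calc Z t = Z t * (Complex.exp (-(φ t * Complex.I)) * Complex.exp (φ t * Complex.I)) := by
        rw [h5, mul_one]
    _ = _ := by rw [← mul_assoc, hconst, one_mul]

/-- Every `C^1` curve on the surface is given in coordinates by `C^1` functions. -/
theorem exists_eq_revCurve {γ : ℝ → RevSurface} (hγ : ContMDiff 𝓘(ℝ, ℝ) revModel 1 γ) {φ₀ : ℝ}
    (h0 : Circle.exp φ₀ = (γ 0).2) :
    ∃ x φ : ℝ → ℝ, ContDiff ℝ 1 x ∧ ContDiff ℝ 1 φ ∧ (∀ t, x t ∈ Ioo (0 : ℝ) 1) ∧ φ 0 = φ₀ ∧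
      γ = revCurve x φ := by
  have h1 : ContDiff ℝ 1 (fun t ↦ ((γ t).1 : ℝ)) :=
    ((contMDiff_subtype_val (n := 1) (I := 𝓘(ℝ, ℝ)) (U := UnitIoo)).comp
      (contMDiff_fst.comp hγ)).contDiff
  have h2 : ContDiff ℝ 1 (fun t ↦ ((γ t).2 : ℂ)) :=
    ((contMDiff_circle_coe.of_le (by simp)).comp (contMDiff_snd.comp hγ)).contDiff
  obtain ⟨φ, hφ, hφ0, h⟩ := exists_lift_circle h2 h0
  refine ⟨_, φ, h1, hφ, fun t ↦ (γ t).1.2, hφ0, ?_⟩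
  funext t
  exact Prod.ext (toUnitIoo_coe _).symm (h t)

end Lift

/-! ### Reparametrization to bounded speed. -/

section Reparametrization

theorem revSpeedSq_smul (r : ℝ → ℝ) (y c w z : ℝ) :
    revSpeedSq r y (w * c) (z * c) = c ^ 2 * revSpeedSq r y w z := by
  unfold revSpeedSq; ring

/-- A primitive of a continuous function bounded below by a positive constant has a `C^1` inverse. -/
theorem exists_inverse_of_integral {f : ℝ → ℝ} (hf : Continuous f) {ε : ℝ} (hε : 0 < ε)
    (h : ∀ t, ε ≤ f t) :
    ∃ τ : ℝ → ℝ, ContDiff ℝ 1 τ ∧ (∀ t, τ (∫ u in (0 : ℝ)..t, f u) = t) ∧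
      ∀ s, deriv τ s = (f (τ s))⁻¹ := by
  set F : ℝ → ℝ := fun t ↦ ∫ u in (0 : ℝ)..t, f u
  have hF : ∀ t, HasDerivAt F (f t) t := fun t ↦ (hf.integral_hasStrictDerivAt 0 t).hasDerivAt
  have hpos : ∀ t, 0 < f t := fun t ↦ hε.trans_le (h t)
  have hmono : StrictMono F := strictMono_of_deriv_pos fun t ↦ by rw [(hF t).deriv]; exact hpos t
  have hF1 : ContDiff ℝ 1 F := by simpa using contDiff_one_integral hf 0
  have hF0 : F 0 = 0 := by simp [F]
  -- Comparison with the line `ε t` makes `F` unbounded in both directions, hence surjective.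
  have hGm : Monotone fun t ↦ F t - ε * t := by
    have hd : ∀ t, HasDerivAt (fun t ↦ F t - ε * t) (f t - ε * 1) t := fun t ↦
      (hF t).sub ((hasDerivAt_id t).const_mul ε)
    refine monotone_of_deriv_nonneg (fun t ↦ (hd t).differentiableAt) fun t ↦ ?_
    rw [(hd t).deriv]
    linarith [h t]
  have htop : Tendsto F atTop atTop := by
    refine tendsto_atTop_mono' atTop ?_ (tendsto_id.const_mul_atTop hε)
    filter_upwards [eventually_ge_atTop 0] with t ht
    have := hGm ht
    simp only [hF0] at this
    simp only [id]
    linarith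
  have hbot : Tendsto F atBot atBot := by
    refine tendsto_atBot_mono' atBot ?_ (tendsto_id.const_mul_atBot hε)
    filter_upwards [eventually_le_atBot 0] with t ht
    have := hGm ht
    simp only [hF0] at this
    simp only [id]
    linarith
  have hsurj : Function.Surjective F := hF1.continuous.surjective htop hbot
  let e : ℝ ≃ₜ ℝ := (hmono.orderIsoOfSurjective F hsurj).toHomeomorph
  have he : ∀ t, e t = F t := fun t ↦ rfl
  have hτ : ContDiff ℝ 1 e.symm :=
    e.contDiff_symm_deriv (fun t ↦ (hpos t).ne') hF hF1
  refine ⟨e.symm, hτ, fun t ↦ e.symm_apply_apply t, fun s ↦ ?_⟩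
  have h1 := (hF (e.symm s)).comp s ((hτ.differentiable one_ne_zero) s).hasDerivAt
  have h2 : F ∘ e.symm = id := funext fun s ↦ e.apply_symm_apply s
  rw [h2] at h1
  exact eq_inv_of_mul_eq_one_right (h1.unique (hasDerivAt_id s))

/-- A `C^1` curve of length `< c` can be reparametrized to have speed at most `c`. -/
theorem exists_reparametrization {r x φ : ℝ → ℝ} (hr : ContDiff ℝ ∞ r) (hx : ContDiff ℝ 1 x)
    (hφ : ContDiff ℝ 1 φ) {c : ℝ}
    (hc : ∫ t in (0 : ℝ)..1, √(revSpeedSq r (x t) (deriv x t) (deriv φ t)) < c) :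
    ∃ X Φ : ℝ → ℝ, ContDiff ℝ 1 X ∧ ContDiff ℝ 1 Φ ∧ X 0 = x 0 ∧ X 1 = x 1 ∧ Φ 0 = φ 0 ∧
      Φ 1 = φ 1 ∧ (∀ t, X t ∈ range x) ∧
      ∀ t, revSpeedSq r (X t) (deriv X t) (deriv Φ t) ≤ c ^ 2 := by
  set v : ℝ → ℝ := fun t ↦ √(revSpeedSq r (x t) (deriv x t) (deriv φ t)) with hv
  have hvc : Continuous v := (continuous_revSpeedSq_curve hr hx hφ).sqrt
  -- The speed `v` may vanish, so arc length need not be invertible. The slack `ε` is added to it: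
  -- `∫ (v + ε)` over `[0, 1]` is exactly `c`, and the new speed is `c v / (v + ε) ≤ c`.
  set ε := c - ∫ t in (0 : ℝ)..1, v t with hε
  have hε0 : 0 < ε := sub_pos.2 hc
  obtain ⟨τ, hτ, hτF, hτ'⟩ := exists_inverse_of_integral (f := fun t ↦ v t + ε)
    (hvc.add continuous_const) hε0 (fun t ↦ by linarith [Real.sqrt_nonneg (revSpeedSq r (x t) (deriv x t) (deriv φ t))])
  have hτ0 : τ 0 = 0 := by simpa using hτF 0
  have hτ1 : τ c = 1 := by
    have := hτF 1
    rw [intervalIntegral.integral_add (hvc.intervalIntegrable _ _) (by simp)] at this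
    simpa [hε] using this
  have hlin : ContDiff ℝ 1 fun t : ℝ ↦ τ (c * t) := hτ.comp (contDiff_const.mul contDiff_id)
  have hd : ∀ t, HasDerivAt (fun t : ℝ ↦ τ (c * t)) ((v (τ (c * t)) + ε)⁻¹ * c) t := fun t ↦ by
    have h1 := ((hτ.differentiable one_ne_zero) (c * t)).hasDerivAt
    rw [hτ'] at h1
    have h2 : HasDerivAt (fun t ↦ c * t) c t := by simpa using (hasDerivAt_id t).const_mul c
    exact h1.comp t h2
  refine ⟨fun t ↦ x (τ (c * t)), fun t ↦ φ (τ (c * t)), hx.comp hlin, hφ.comp hlin,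
    by simp [hτ0], by simp [hτ1], by simp [hτ0], by simp [hτ1], fun t ↦ mem_range_self _,
    fun t ↦ ?_⟩
  have hX := (((hx.differentiable one_ne_zero) _).hasDerivAt.comp t (hd t)).deriv
  have hΦ := (((hφ.differentiable one_ne_zero) _).hasDerivAt.comp t (hd t)).deriv
  simp only [Function.comp_def] at hX hΦ
  rw [hX, hΦ, revSpeedSq_smul]
  set s := τ (c * t)
  have hsq : revSpeedSq r (x s) (deriv x s) (deriv φ s) = v s ^ 2 :=
    (Real.sq_sqrt (revSpeedSq_nonneg r _ _ _)).symm
  rw [hsq]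
  have hvs : 0 ≤ v s := Real.sqrt_nonneg _
  have h3 : (v s + ε)⁻¹ * v s ≤ 1 := by
    rw [inv_mul_le_one₀ (by linarith)]; linarith
  have h4 : 0 ≤ (v s + ε)⁻¹ * v s := by positivity
  calc ((v s + ε)⁻¹ * c) ^ 2 * v s ^ 2 = ((v s + ε)⁻¹ * v s) ^ 2 * c ^ 2 := by ring
    _ ≤ 1 * c ^ 2 := by gcongr; exact pow_le_one₀ h4 h3
    _ = c ^ 2 := one_mul _

end Reparametrization

/-! ### The distance as a continuous function, and confinement of almost minimizers away from the
tips. -/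

section Confinement

variable (r : ℝ → ℝ) (hr : ContDiff ℝ ∞ r) (hpos : ∀ x ∈ Ioo (0 : ℝ) 1, 0 < r x)

theorem revCurve_eq {x φ : ℝ → ℝ} {t : ℝ} {p : RevSurface} (h1 : x t = p.1)
    (h2 : Circle.exp (φ t) = p.2) : revCurve x φ t = p :=
  Prod.ext (by simp only [revCurve, h1, toUnitIoo_coe]) h2

/-- The segment in the coordinates `(x, φ)` stays on the surface because `(0, 1)` is convex. -/
theorem revEDist_ne_top (p q : RevSurface) : revEDist r hr hpos p q ≠ ⊤ := by
  let x : ℝ → ℝ := fun t ↦ (p.1 : ℝ) + t * ((q.1 : ℝ) - p.1)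
  let φ : ℝ → ℝ := fun t ↦ Complex.arg p.2 + t * (Complex.arg q.2 - Complex.arg p.2)
  have hx : ContDiff ℝ 1 x := by fun_prop
  have hφ : ContDiff ℝ 1 φ := by fun_prop
  have h : ∀ t ∈ Icc (0 : ℝ) 1, x t ∈ Ioo (0 : ℝ) 1 := fun t ht ↦
    (convex_Ioo (0 : ℝ) 1).add_smul_sub_mem p.1.2 q.1.2 ht
  have := revEDist_revCurve_le r hr hpos zero_le_one hx hφ h
  rw [revCurve_eq (p := p) (by simp [x]) (by simp [φ, Circle.exp_arg]),
    revCurve_eq (p := q) (by simp [x]) (by simp [φ, Circle.exp_arg])] at this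
  exact ne_top_of_le_ne_top ENNReal.ofReal_ne_top this

/-- The distance on the surface, as a real number. -/
def revDist (p q : RevSurface) : ℝ := (revEDist r hr hpos p q).toReal

theorem ofReal_revDist (p q : RevSurface) :
    ENNReal.ofReal (revDist r hr hpos p q) = revEDist r hr hpos p q :=
  ENNReal.ofReal_toReal (revEDist_ne_top r hr hpos p q)

theorem revDist_nonneg (p q : RevSurface) : 0 ≤ revDist r hr hpos p q := ENNReal.toReal_nonneg

theorem revDist_self (p : RevSurface) : revDist r hr hpos p p = 0 := by
  simp [revDist, revEDist_self]

theorem revDist_comm (p q : RevSurface) : revDist r hr hpos p q = revDist r hr hpos q p := by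
  simp only [revDist, revEDist_comm r hr hpos p q]

theorem revDist_triangle (p q s : RevSurface) :
    revDist r hr hpos p s ≤ revDist r hr hpos p q + revDist r hr hpos q s := by
  unfold revDist
  rw [← ENNReal.toReal_add (revEDist_ne_top r hr hpos _ _) (revEDist_ne_top r hr hpos _ _)]
  exact ENNReal.toReal_mono (ENNReal.add_ne_top.2
    ⟨revEDist_ne_top r hr hpos _ _, revEDist_ne_top r hr hpos _ _⟩) (revEDist_triangle r hr hpos p q s)

theorem continuous_revDist :
    Continuous fun x : RevSurface × RevSurface ↦ revDist r hr hpos x.1 x.2 := by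
  rw [continuous_iff_continuousAt]
  rintro ⟨p, q⟩
  rw [Metric.continuousAt_iff']
  intro ε hε
  have key : ∀ p : RevSurface, ∀ᶠ y in 𝓝 p, revDist r hr hpos p y < ε / 2 := fun p ↦ by
    filter_upwards [eventually_revEDist_lt r hr hpos p
      (ENNReal.ofReal_pos.2 (half_pos hε))] with y hy
    rw [← ofReal_revDist] at hy
    exact (ENNReal.ofReal_lt_ofReal_iff (half_pos hε)).1 hy
  filter_upwards [(key p).prod_nhds (key q)] with y hy
  rw [Real.dist_eq, abs_sub_lt_iff]
  have h1 := revDist_triangle r hr hpos y.1 p y.2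
  have h2 := revDist_triangle r hr hpos p q y.2
  have h3 := revDist_triangle r hr hpos p y.1 q
  have h4 := revDist_triangle r hr hpos y.1 y.2 q
  have h5 := revDist_comm r hr hpos y.1 p
  have h6 := revDist_comm r hr hpos y.2 q
  constructor <;> linarith [hy.1, hy.2]

theorem revDist_revCurve_le {x φ : ℝ → ℝ} {a b : ℝ} (hab : a ≤ b) (hx : ContDiff ℝ 1 x)
    (hφ : ContDiff ℝ 1 φ) (h : ∀ t ∈ Icc a b, x t ∈ Ioo (0 : ℝ) 1) :
    revDist r hr hpos (revCurve x φ a) (revCurve x φ b) ≤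
      ∫ t in a..b, √(revSpeedSq r (x t) (deriv x t) (deriv φ t)) := by
  refine ENNReal.toReal_le_of_le_ofReal ?_ (revEDist_revCurve_le r hr hpos hab hx hφ h)
  exact intervalIntegral.integral_nonneg hab fun _ _ ↦ Real.sqrt_nonneg _

/-- Two points on the same circle of latitude are at distance at most the length of the circle. -/
theorem revDist_latitude_le {l : ℝ} (hl : l ∈ Ioo (0 : ℝ) 1) (α β : ℝ) :
    revDist r hr hpos (toUnitIoo l, Circle.exp α) (toUnitIoo l, Circle.exp β) ≤
      2 * Real.pi * r l := by
  -- Choosing the representative of `β` in `[α, α + 2π)` makes the arc less than one full turn.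
  obtain ⟨β', hβ', hexp⟩ := Circle.periodic_exp.exists_mem_Ico Real.two_pi_pos β α
  rw [hexp]
  let φ : ℝ → ℝ := fun t ↦ α + t * (β' - α)
  have hφ : ContDiff ℝ 1 φ := by fun_prop
  have hd : ∀ t, deriv φ t = β' - α := fun t ↦ by simp [φ]
  have := revDist_revCurve_le r hr hpos zero_le_one (contDiff_const (c := l)) hφ (fun _ _ ↦ hl)
  have h2 : √(revSpeedSq r l 0 (β' - α)) = r l * (β' - α) := by
    rw [show revSpeedSq r l 0 (β' - α) = (r l * (β' - α)) ^ 2 by unfold revSpeedSq; ring,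
      Real.sqrt_sq (mul_nonneg (hpos l hl).le (sub_nonneg.2 hβ'.1))]
  simp only [deriv_const, hd, h2] at this
  simp [revCurve, φ] at this
  refine this.trans ?_
  have := hpos l hl
  nlinarith [hβ'.2]

/-- The speed dominates `|x'|`, so moving between latitudes costs at least the difference in `x`. -/
theorem abs_sub_le_integral_speed {x φ : ℝ → ℝ} (hx : ContDiff ℝ 1 x) (hφ : ContDiff ℝ 1 φ)
    {r : ℝ → ℝ} (hr : ContDiff ℝ ∞ r) {a b : ℝ} (hab : a ≤ b) :
    |x b - x a| ≤ ∫ t in a..b, √(revSpeedSq r (x t) (deriv x t) (deriv φ t)) := by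
  have hx' := hx.continuous_deriv le_rfl
  rw [← intervalIntegral.integral_deriv_eq_sub (fun t _ ↦ (hx.differentiable one_ne_zero) t)
    (hx'.intervalIntegrable _ _)]
  refine (intervalIntegral.abs_integral_le_integral_abs hab).trans ?_
  refine intervalIntegral.integral_mono_on hab (hx'.abs.intervalIntegrable _ _)
    ((continuous_revSpeedSq_curve hr hx hφ).sqrt.intervalIntegrable _ _) fun t _ ↦ ?_
  exact Real.abs_le_sqrt (sq_le_revSpeedSq r _ _ _)

/-- A curve that leaves a circle of latitude and comes back to it can be shortened by
following the circle instead. -/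
theorem revDist_add_le_of_excursion {x φ : ℝ → ℝ} (hx : ContDiff ℝ 1 x) (hφ : ContDiff ℝ 1 φ)
    (h : ∀ t, x t ∈ Ioo (0 : ℝ) 1) {l t₁ s t₂ : ℝ} (h1 : t₁ ∈ Icc 0 s) (h2 : t₂ ∈ Icc s 1)
    (hl1 : x t₁ = l) (hl2 : x t₂ = l) :
    revDist r hr hpos (revCurve x φ 0) (revCurve x φ 1) + 2 * |x s - l| ≤
      (∫ t in (0 : ℝ)..1, √(revSpeedSq r (x t) (deriv x t) (deriv φ t))) + 2 * Real.pi * r l := by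
  have hi : ∀ a b : ℝ, IntervalIntegrable
      (fun t ↦ √(revSpeedSq r (x t) (deriv x t) (deriv φ t))) volume a b := fun a b ↦
    (continuous_revSpeedSq_curve hr hx hφ).sqrt.intervalIntegrable _ _
  -- The length is split at `t₁`, `s` and `t₂`. The outer pieces are kept; each of the two inner
  -- pieces has length at least `|x s - l|`, and both are replaced by an arc of the latitude circle.
  have e1 := intervalIntegral.integral_add_adjacent_intervals (hi 0 t₁) (hi t₁ 1)
  have e2 := intervalIntegral.integral_add_adjacent_intervals (hi t₁ s) (hi s 1)
  have e3 := intervalIntegral.integral_add_adjacent_intervals (hi s t₂) (hi t₂ 1)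
  have d1 := revDist_revCurve_le r hr hpos h1.1 hx hφ fun t _ ↦ h t
  have d2 := revDist_revCurve_le r hr hpos h2.2 hx hφ fun t _ ↦ h t
  have d3 := revDist_latitude_le r hr hpos (l := l) (hl1 ▸ h t₁) (φ t₁) (φ t₂)
  have a1 := abs_sub_le_integral_speed hx hφ hr h1.2
  have a2 := abs_sub_le_integral_speed hx hφ hr h2.1
  have c1 : revCurve x φ t₁ = (toUnitIoo l, Circle.exp (φ t₁)) := by simp [revCurve, hl1]
  have c2 : revCurve x φ t₂ = (toUnitIoo l, Circle.exp (φ t₂)) := by simp [revCurve, hl2]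
  have T1 := revDist_triangle r hr hpos (revCurve x φ 0) (revCurve x φ t₁) (revCurve x φ 1)
  have T2 := revDist_triangle r hr hpos (revCurve x φ t₁) (revCurve x φ t₂) (revCurve x φ 1)
  rw [c1, c2] at T2
  rw [c1] at T1 d1
  rw [c2] at d2
  rw [hl1] at a1
  rw [hl2, abs_sub_comm] at a2
  linarith

/-- As `r(0) = 0`, the quotient `r(l) / l` tends to `r'(0) < 1 / (2π)` from the right. -/
theorem exists_level_near_zero (h0 : r 0 = 0) (hr : ContDiff ℝ ∞ r)
    (hd0 : |deriv r 0| < 1 / (2 * Real.pi)) {c : ℝ} (hc : 0 < c) :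
    ∃ l, 0 < l ∧ l ≤ c ∧ 2 * Real.pi * r l < l := by
  have hd : HasDerivAt r (deriv r 0) 0 := ((hr.differentiable (by simp)) 0).hasDerivAt
  have h1 := hd.tendsto_slope_zero_right
  simp only [zero_add, h0, sub_zero, smul_eq_mul] at h1
  have h2 := h1.eventually (eventually_lt_nhds ((le_abs_self _).trans_lt hd0))
  obtain ⟨l, hl, hl1, hl2⟩ := (h2.and (Ioc_mem_nhdsGT hc)).exists
  refine ⟨l, hl1, hl2, ?_⟩
  rw [inv_mul_lt_iff₀ hl1, mul_one_div, lt_div_iff₀ Real.two_pi_pos] at hl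
  linarith

/-- Reflection `t ↦ 1 - t` of the previous case. -/
theorem exists_level_near_one (h1 : r 1 = 0) (hr : ContDiff ℝ ∞ r)
    (hd1 : |deriv r 1| < 1 / (2 * Real.pi)) {c : ℝ} (hc : 0 < c) :
    ∃ l, 0 < l ∧ l ≤ c ∧ 2 * Real.pi * r (1 - l) < l := by
  refine exists_level_near_zero (fun t ↦ r (1 - t)) (by simpa using h1)
    (hr.comp (contDiff_const.sub contDiff_id)) ?_ hc
  rw [deriv_comp_const_sub]
  simpa using hd1

/-- Almost minimizing curves with given endpoints stay in a compact part of the surface. -/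
theorem exists_confinement (h0 : r 0 = 0) (h1 : r 1 = 0)
    (hd0 : |deriv r 0| < 1 / (2 * Real.pi)) (hd1 : |deriv r 1| < 1 / (2 * Real.pi))
    (p q : RevSurface) :
    ∃ δ > 0, ∃ g > 0, ∀ x φ : ℝ → ℝ, ContDiff ℝ 1 x → ContDiff ℝ 1 φ →
      (∀ t, x t ∈ Ioo (0 : ℝ) 1) → revCurve x φ 0 = p → revCurve x φ 1 = q →
      (∫ t in (0 : ℝ)..1, √(revSpeedSq r (x t) (deriv x t) (deriv φ t))) <
        revDist r hr hpos p q + g →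
      ∀ t ∈ Icc (0 : ℝ) 1, x t ∈ Icc δ (1 - δ) := by
  obtain ⟨l, hl0, hlc, hl⟩ := exists_level_near_zero r h0 hr hd0
    (lt_min p.1.2.1 q.1.2.1)
  obtain ⟨m, hm0, hmc, hm⟩ := exists_level_near_one r h1 hr hd1
    (lt_min (sub_pos.2 p.1.2.2) (sub_pos.2 q.1.2.2))
  -- Going from level `l` below `l / 2` and back costs more than `2 (l / 2) = l`, while the circle
  -- costs at most `2π r(l)`. The gap `l - 2π r(l)`, and its analogue at the other tip, bounds the
  -- admissible excess length.
  refine ⟨min (l / 2) (m / 2), by positivity, min (l - 2 * Real.pi * r l)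
    (m - 2 * Real.pi * r (1 - m)), lt_min (by linarith) (by linarith), ?_⟩
  intro x φ hx hφ hI e0 e1 hlen t ht
  have x0 : x 0 = p.1 := by rw [← e0]; exact (coe_toUnitIoo (hI 0)).symm
  have x1 : x 1 = q.1 := by rw [← e1]; exact (coe_toUnitIoo (hI 1)).symm
  have hlp := hlc.trans (min_le_left _ _)
  have hlq := hlc.trans (min_le_right _ _)
  have hmp := hmc.trans (min_le_left _ _)
  have hmq := hmc.trans (min_le_right _ _)
  have hg1 := min_le_left (l - 2 * Real.pi * r l) (m - 2 * Real.pi * r (1 - m))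
  have hg2 := min_le_right (l - 2 * Real.pi * r l) (m - 2 * Real.pi * r (1 - m))
  constructor
  · by_contra! hlt
    have hlt' := hlt.trans_le (min_le_left _ _)
    obtain ⟨t₁, ht₁, e₁⟩ := intermediate_value_Icc' ht.1 hx.continuous.continuousOn
      (show l ∈ Icc (x t) (x 0) from ⟨by linarith, by linarith⟩)
    obtain ⟨t₂, ht₂, e₂⟩ := intermediate_value_Icc ht.2 hx.continuous.continuousOn
      (show l ∈ Icc (x t) (x 1) from ⟨by linarith, by linarith⟩)
    have := revDist_add_le_of_excursion r hr hpos hx hφ hI ht₁ ht₂ e₁ e₂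
    rw [e0, e1] at this
    linarith [neg_abs_le (x t - l)]
  · by_contra! hlt
    have hlt' : 1 - m / 2 < x t := by linarith [min_le_right (l / 2) (m / 2)]
    obtain ⟨t₁, ht₁, e₁⟩ := intermediate_value_Icc ht.1 hx.continuous.continuousOn
      (show 1 - m ∈ Icc (x 0) (x t) from ⟨by linarith, by linarith⟩)
    obtain ⟨t₂, ht₂, e₂⟩ := intermediate_value_Icc' ht.2 hx.continuous.continuousOn
      (show 1 - m ∈ Icc (x 1) (x t) from ⟨by linarith, by linarith⟩)
    have := revDist_add_le_of_excursion r hr hpos hx hφ hI ht₁ ht₂ e₁ e₂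
    rw [e0, e1] at this
    linarith [le_abs_self (x t - (1 - m))]

end Confinement

/-! ### Approximate Euler-Lagrange equations from explicit competitors. -/

section Variations

/-- `P` minus its mean is orthogonal to constants. This turns a first variation along that direction
into a square. -/
theorem integral_mul_sub_mean {P : ℝ → ℝ} (hP : Continuous P) :
    ∫ t in (0 : ℝ)..1, P t * (P t - ∫ u in (0 : ℝ)..1, P u) =
      ∫ t in (0 : ℝ)..1, (P t - ∫ u in (0 : ℝ)..1, P u) ^ 2 := by
  set c := ∫ u in (0 : ℝ)..1, P u with hc
  have h : ∫ t in (0 : ℝ)..1, c * (P t - c) = 0 := by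
    rw [intervalIntegral.integral_const_mul, intervalIntegral.integral_sub
      (hP.intervalIntegrable _ _) (by simp), ← hc]
    simp
  have i1 : IntervalIntegrable (fun t ↦ (P t - c) ^ 2) volume 0 1 :=
    Continuous.intervalIntegrable (by fun_prop) _ _
  have i2 : IntervalIntegrable (fun t ↦ c * (P t - c)) volume 0 1 :=
    Continuous.intervalIntegrable (by fun_prop) _ _
  have e := intervalIntegral.integral_add i1 i2
  rw [h, add_zero] at e
  rw [← e]
  refine intervalIntegral.integral_congr fun t _ ↦ ?_
  ring

theorem integral_sub_mean {P : ℝ → ℝ} (hP : Continuous P) :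
    ∫ t in (0 : ℝ)..1, (P t - ∫ u in (0 : ℝ)..1, P u) = 0 := by
  rw [intervalIntegral.integral_sub (hP.intervalIntegrable _ _) (by simp)]
  simp

/-- If `ν` almost minimizes `∫ β ν²` among functions with the same integral, then `β ν` is almost
constant. -/
theorem integral_sq_momentum_sub_mean_le {α β ν : ℝ → ℝ} (hα : Continuous α) (hβ : Continuous β)
    (hν : Continuous ν) {B m : ℝ} (hB : 0 < B) (hβB : ∀ t ∈ Icc (0 : ℝ) 1, β t ≤ B)
    (h : ∀ η : ℝ → ℝ, Continuous η → ∫ t in (0 : ℝ)..1, η t = 0 →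
      m ≤ ∫ t in (0 : ℝ)..1, (α t + β t * (ν t + η t) ^ 2)) :
    ∫ t in (0 : ℝ)..1, (β t * ν t - ∫ u in (0 : ℝ)..1, β u * ν u) ^ 2 ≤
      B * ((∫ t in (0 : ℝ)..1, (α t + β t * ν t ^ 2)) - m) := by
  have hPc : Continuous fun t ↦ β t * ν t := hβ.mul hν
  have h1 := integral_mul_sub_mean hPc
  have h2 := integral_sub_mean hPc
  set c := ∫ u in (0 : ℝ)..1, β u * ν u
  have h3 := h (fun t ↦ -B⁻¹ * (β t * ν t - c)) (by fun_prop)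
    (by rw [intervalIntegral.integral_const_mul, h2, mul_zero])
  have hle : ∫ t in (0 : ℝ)..1, (α t + β t * (ν t + -B⁻¹ * (β t * ν t - c)) ^ 2) ≤
      ∫ t in (0 : ℝ)..1, ((α t + β t * ν t ^ 2) - 2 * B⁻¹ * (β t * ν t * (β t * ν t - c)) +
        B⁻¹ * (β t * ν t - c) ^ 2) := by
    refine intervalIntegral.integral_mono_on zero_le_one
      (Continuous.intervalIntegrable (by fun_prop) _ _)
      (Continuous.intervalIntegrable (by fun_prop) _ _) fun t ht ↦ ?_
    have e : β t * B⁻¹ ≤ 1 := by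
      rw [← div_eq_mul_inv, div_le_one hB]; exact hβB t ht
    have e2 : 0 ≤ B⁻¹ * (β t * ν t - c) ^ 2 := by positivity
    nlinarith [mul_le_mul_of_nonneg_right e e2]
  replace hle := h3.trans hle
  rw [intervalIntegral.integral_add (Continuous.intervalIntegrable (by fun_prop) _ _)
    (Continuous.intervalIntegrable (by fun_prop) _ _),
    intervalIntegral.integral_sub (Continuous.intervalIntegrable (by fun_prop) _ _)
    (Continuous.intervalIntegrable (by fun_prop) _ _), intervalIntegral.integral_const_mul,
    intervalIntegral.integral_const_mul, h1] at hle
  set I := ∫ t in (0 : ℝ)..1, (β t * ν t - c) ^ 2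
  have h4 : B⁻¹ * I ≤ (∫ t in (0 : ℝ)..1, (α t + β t * ν t ^ 2)) - m := by linarith
  rwa [inv_mul_le_iff₀ hB] at h4

/-- Second order Taylor bound, uniform on `[0, 1]`. -/
theorem exists_taylor_bound {a : ℝ → ℝ} (ha : ContDiff ℝ 2 a) :
    ∃ A, 1 ≤ A ∧ (∀ y ∈ Icc (0 : ℝ) 1, |a y| ≤ A) ∧ (∀ y ∈ Icc (0 : ℝ) 1, |deriv a y| ≤ A) ∧
      ∀ y ∈ Icc (0 : ℝ) 1, ∀ h, y + h ∈ Icc (0 : ℝ) 1 →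
        a (y + h) ≤ a y + deriv a y * h + A * h ^ 2 := by
  have ha1 : ContDiff ℝ 1 (deriv a) := ((contDiff_succ_iff_deriv (n := 1)).1 ha).2.2
  have ha2 : Continuous (deriv (deriv a)) := ha1.continuous_deriv le_rfl
  obtain ⟨A0, hA0⟩ := isCompact_Icc.exists_bound_of_continuousOn
    (ha.continuous.continuousOn (s := Icc (0 : ℝ) 1))
  obtain ⟨A1, hA1⟩ := isCompact_Icc.exists_bound_of_continuousOn
    (ha1.continuous.continuousOn (s := Icc (0 : ℝ) 1))
  obtain ⟨A2, hA2⟩ := isCompact_Icc.exists_bound_of_continuousOn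
    (ha2.continuousOn (s := Icc (0 : ℝ) 1))
  set A := max 1 (max A0 (max A1 A2)) with hA
  have b0 : A0 ≤ A := by simp [hA]
  have b1 : A1 ≤ A := by simp [hA]
  have b2 : A2 ≤ A := by simp [hA]
  refine ⟨A, le_max_left _ _, fun y hy ↦ (hA0 y hy).trans b0, fun y hy ↦ (hA1 y hy).trans b1,
    fun y hy h hh ↦ ?_⟩
  have hsub : uIcc y (y + h) ⊆ Icc 0 1 := (ordConnected_Icc.uIcc_subset hy hh)
  have hlip : ∀ z ∈ uIcc y (y + h), ‖deriv a z - deriv a y‖ ≤ A * |h| := fun z hz ↦ by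
    have := (convex_Icc (0 : ℝ) 1).norm_image_sub_le_of_norm_deriv_le
      (fun z _ ↦ (ha1.differentiable one_ne_zero) z) hA2 hy (hsub hz)
    refine this.trans ?_
    have h3 := abs_sub_left_of_mem_uIcc hz
    have h3' : ‖z - y‖ ≤ |h| := by simpa [Real.norm_eq_abs] using h3
    exact mul_le_mul b2 h3' (norm_nonneg _) (by positivity)
  -- The mean value inequality is applied a second time, to `a` minus its linear part at `y`.
  have hd : ∀ z, HasDerivAt (fun z ↦ a z - deriv a y * z) (deriv a z - deriv a y) z := fun z ↦ by
    have h1 := ((hasDerivAt_id z).const_mul (deriv a y))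
    rw [mul_one] at h1
    exact ((ha.differentiable (by simp)) z).hasDerivAt.sub h1
  have := (convex_uIcc y (y + h)).norm_image_sub_le_of_norm_deriv_le
    (fun z _ ↦ (hd z).differentiableAt) (fun z hz ↦ by rw [(hd z).deriv]; exact hlip z hz)
    left_mem_uIcc right_mem_uIcc
  have h5 := (le_abs_self _).trans this
  rw [add_sub_cancel_left, Real.norm_eq_abs, mul_assoc, ← sq, sq_abs] at h5
  linarith

/-- Here `a₀, a₁, a₂` stand for `a(x), a'(x), a(x - sζ)`, similarly for `b`, and `η = ζ'`, `w = x'`,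
`z = φ'`. The terms of order zero and one in `s` are kept exactly; the five remaining ones
contribute `1 + 2 + 1 + 4 + 1 = 9` times `C ^ 5`. -/
theorem variation_pointwise_bound {A w z C s a₀ a₁ a₂ b₀ b₁ b₂ : ℝ} (hC : 1 ≤ C) (hs : 0 ≤ s)
    (hs1 : s ≤ 1) (hAC : A ≤ C) {ζ η : ℝ} (hζ : |ζ| ≤ C) (hη : |η| ≤ C)
    (hw : |w| ≤ C) (hz : |z| ≤ C) (ha₀ : |a₀| ≤ C) (ha₁ : |a₁| ≤ C)
    (ha : a₂ ≤ a₀ + a₁ * (-s * ζ) + A * (-s * ζ) ^ 2)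
    (hb : b₂ ≤ b₀ + b₁ * (-s * ζ) + A * (-s * ζ) ^ 2) :
    a₂ * (w + -s * η) ^ 2 + b₂ * z ^ 2 ≤ a₀ * w ^ 2 + b₀ * z ^ 2 -
      s * (2 * a₀ * w * η + (a₁ * w ^ 2 + b₁ * z ^ 2) * ζ) + s ^ 2 * (9 * C ^ 5) := by
  have h1 := mul_le_mul_of_nonneg_right ha (sq_nonneg (w + -s * η))
  have h2 := mul_le_mul_of_nonneg_right hb (sq_nonneg z)
  have hC0 : 0 ≤ C := by linarith
  have pw : ∀ {i j : ℕ}, i ≤ j → C ^ i ≤ C ^ j := fun h ↦ pow_le_pow_right₀ hC h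
  have t1 : a₀ * η ^ 2 ≤ C ^ 5 := by
    refine (le_abs_self _).trans ?_
    rw [abs_mul, abs_pow]
    calc |a₀| * |η| ^ 2 ≤ C * C ^ 2 := by gcongr
      _ = C ^ 3 := by ring
      _ ≤ C ^ 5 := pw (by norm_num)
  have t2 : 2 * (a₁ * ζ * w * η) ≤ 2 * C ^ 5 := by
    have : a₁ * ζ * w * η ≤ C ^ 5 := by
      refine (le_abs_self _).trans ?_
      rw [abs_mul, abs_mul, abs_mul]
      calc |a₁| * |ζ| * |w| * |η| ≤ C * C * C * C := by gcongr
        _ = C ^ 4 := by ring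
        _ ≤ C ^ 5 := pw (by norm_num)
    linarith
  have t3 : -s * (a₁ * ζ * η ^ 2) ≤ C ^ 5 := by
    refine (le_abs_self _).trans ?_
    rw [abs_mul, abs_mul, abs_mul, abs_pow, abs_neg, abs_of_nonneg hs]
    calc s * (|a₁| * |ζ| * |η| ^ 2) ≤ 1 * (C * C * C ^ 2) := by gcongr
      _ = C ^ 4 := by ring
      _ ≤ C ^ 5 := pw (by norm_num)
  have t4 : A * ζ ^ 2 * (w + -s * η) ^ 2 ≤ 4 * C ^ 5 := by
    have e : |w + -s * η| ≤ 2 * C := by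
      refine (abs_add_le _ _).trans ?_
      rw [abs_mul, abs_neg, abs_of_nonneg hs]
      have : s * |η| ≤ 1 * C := by gcongr
      linarith
    rw [← sq_abs ζ, ← sq_abs (w + -s * η)]
    calc A * |ζ| ^ 2 * |w + -s * η| ^ 2 ≤ C * C ^ 2 * (2 * C) ^ 2 := by gcongr
      _ = 4 * C ^ 5 := by ring
  have t5 : A * ζ ^ 2 * z ^ 2 ≤ C ^ 5 := by
    rw [← sq_abs ζ, ← sq_abs z]
    calc A * |ζ| ^ 2 * |z| ^ 2 ≤ C * C ^ 2 * C ^ 2 := by gcongr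
      _ = C ^ 5 := by ring
  have hs2 := mul_le_mul_of_nonneg_left (add_le_add (add_le_add (add_le_add (add_le_add t1 t2) t3)
    t4) t5) (sq_nonneg s)
  linarith

/-- If a curve almost minimizes the energy `∫ a(x) x'² + b(x) φ'²` among the curves with the same
endpoints, then the first component of the Euler-Lagrange equation almost holds. -/
theorem integral_sq_eulerLagrange_le {a b x ν : ℝ → ℝ} (ha : ContDiff ℝ 2 a) (hb : ContDiff ℝ 2 b)
    (hx : ContDiff ℝ 1 x) (hν : Continuous ν) {A C s m δ : ℝ} (hC : 1 ≤ C) (hs : 0 < s)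
    (hs1 : s ≤ 1) (hAC : A ≤ C) (hsδ : s * C < δ)
    (haA : ∀ y ∈ Icc (0 : ℝ) 1, ∀ h, y + h ∈ Icc (0 : ℝ) 1 →
        a (y + h) ≤ a y + deriv a y * h + A * h ^ 2)
    (hbA : ∀ y ∈ Icc (0 : ℝ) 1, ∀ h, y + h ∈ Icc (0 : ℝ) 1 →
        b (y + h) ≤ b y + deriv b y * h + A * h ^ 2)
    (hxδ : ∀ t ∈ Icc (0 : ℝ) 1, x t ∈ Icc δ (1 - δ))
    (hx' : ∀ t ∈ Icc (0 : ℝ) 1, |deriv x t| ≤ C) (hν' : ∀ t ∈ Icc (0 : ℝ) 1, |ν t| ≤ C)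
    (ha₀ : ∀ t ∈ Icc (0 : ℝ) 1, |a (x t)| ≤ C) (ha₁ : ∀ t ∈ Icc (0 : ℝ) 1, |deriv a (x t)| ≤ C)
    {F W : ℝ → ℝ} {k : ℝ}
    (hF : F = fun t ↦ ∫ u in (0 : ℝ)..t, (deriv a (x u) * deriv x u ^ 2 + deriv b (x u) * ν u ^ 2))
    (hW : W = fun t ↦ 2 * a (x t) * deriv x t - F t) (hk : k = ∫ t in (0 : ℝ)..1, W t)
    (hη : ∀ t ∈ Icc (0 : ℝ) 1, |W t - k| ≤ C)
    (h : ∀ ξ : ℝ → ℝ, ContDiff ℝ 1 ξ → ξ 0 = 0 → ξ 1 = 0 →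
      (∀ t ∈ Icc (0 : ℝ) 1, x t + ξ t ∈ Ioo (0 : ℝ) 1) →
      m ≤ ∫ t in (0 : ℝ)..1, (a (x t + ξ t) * (deriv x t + deriv ξ t) ^ 2 +
        b (x t + ξ t) * ν t ^ 2)) :
    ∫ t in (0 : ℝ)..1, (W t - k) ^ 2 ≤
      ((∫ t in (0 : ℝ)..1, (a (x t) * deriv x t ^ 2 + b (x t) * ν t ^ 2)) - m) / s +
        s * (9 * C ^ 5) := by
  have hac := ha.continuous
  have hbc := hb.continuous
  have hxc := hx.continuous
  have hxd := hx.continuous_deriv le_rfl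
  have had : Continuous (deriv a) := ha.continuous_deriv (by simp)
  have hbd : Continuous (deriv b) := hb.continuous_deriv (by simp)
  set f : ℝ → ℝ := fun u ↦ deriv a (x u) * deriv x u ^ 2 + deriv b (x u) * ν u ^ 2 with hf
  have hfc : Continuous f := by fun_prop
  have hFd : ∀ t, HasDerivAt F (f t) t := fun t ↦ by
    rw [hF]; exact (hfc.integral_hasStrictDerivAt 0 t).hasDerivAt
  have hFc : Continuous F := continuous_iff_continuousAt.2 fun t ↦ (hFd t).continuousAt
  have hWc : Continuous W := by rw [hW]; fun_prop
  have hm1 := integral_mul_sub_mean hWc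
  have hm2 := integral_sub_mean hWc
  rw [← hk] at hm1 hm2
  -- The competitor is `x - s ζ` with `ζ' = W - k`, in the spirit of du Bois-Reymond; `ζ` vanishes
  -- at both ends because `W - k` has mean zero.
  set η : ℝ → ℝ := fun t ↦ W t - k with hηdef
  have hηc : Continuous η := by fun_prop
  set ζ : ℝ → ℝ := fun t ↦ ∫ u in (0 : ℝ)..t, η u with hζdef
  have hζ1 : ContDiff ℝ 1 ζ := by simpa using contDiff_one_integral hηc 0
  have hζc := hζ1.continuous
  have hζd : ∀ t, HasDerivAt ζ (η t) t := fun t ↦ (hηc.integral_hasStrictDerivAt 0 t).hasDerivAt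
  have hζ00 : ζ 0 = 0 := by simp [hζdef]
  have hζ11 : ζ 1 = 0 := hm2
  have hζb : ∀ t ∈ Icc (0 : ℝ) 1, |ζ t| ≤ C := fun t ht ↦ by
    have := intervalIntegral.norm_integral_le_of_norm_le_const (a := 0) (b := t) (f := η) (C := C)
      (fun u hu ↦ by
        rw [uIoc_of_le ht.1] at hu
        exact hη u ⟨hu.1.le, hu.2.trans ht.2⟩)
    rw [Real.norm_eq_abs, sub_zero, abs_of_nonneg ht.1] at this
    exact this.trans (mul_le_of_le_one_right (by linarith) ht.2)
  have hin : ∀ t ∈ Icc (0 : ℝ) 1, x t + -s * ζ t ∈ Ioo (0 : ℝ) 1 := fun t ht ↦ by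
    have e : |-s * ζ t| < δ := by
      rw [abs_mul, abs_neg, abs_of_pos hs]
      exact (mul_le_mul_of_nonneg_left (hζb t ht) hs.le).trans_lt hsδ
    rw [abs_lt] at e
    constructor <;> linarith [(hxδ t ht).1, (hxδ t ht).2]
  have hxin : ∀ t ∈ Icc (0 : ℝ) 1, x t ∈ Icc (0 : ℝ) 1 := fun t ht ↦ by
    have : 0 < δ := lt_of_le_of_lt (by positivity) hsδ
    constructor <;> linarith [(hxδ t ht).1, (hxδ t ht).2]
  have hξd : ∀ t, deriv (fun t ↦ -s * ζ t) t = -s * η t := fun t ↦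
    ((hζd t).const_mul (-s)).deriv
  have hm := h (fun t ↦ -s * ζ t) (contDiff_const.mul hζ1) (by simp [hζ00]) (by simp [hζ11]) hin
  simp only [hξd] at hm
  -- Integration by parts removes `ζ`, so the first variation becomes `∫ W η`, which equals `∫ (W -
  -- k)²`.
  have hibp : ∫ t in (0 : ℝ)..1, f t * ζ t = - ∫ t in (0 : ℝ)..1, F t * η t := by
    have e := intervalIntegral.integral_mul_deriv_eq_deriv_mul (a := 0) (b := 1)
      (fun t _ ↦ hFd t) (fun t _ ↦ hζd t) (hfc.intervalIntegrable _ _) (hηc.intervalIntegrable _ _)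
    rw [hζ00, hζ11] at e
    linarith
  have hle : ∫ t in (0 : ℝ)..1, (a (x t + -s * ζ t) * (deriv x t + -s * η t) ^ 2 +
        b (x t + -s * ζ t) * ν t ^ 2) ≤
      ∫ t in (0 : ℝ)..1, ((a (x t) * deriv x t ^ 2 + b (x t) * ν t ^ 2) -
        s * (2 * a (x t) * deriv x t * η t + f t * ζ t) + s ^ 2 * (9 * C ^ 5)) := by
    refine intervalIntegral.integral_mono_on zero_le_one
      (Continuous.intervalIntegrable (by fun_prop) _ _)
      (Continuous.intervalIntegrable (by fun_prop) _ _) fun t ht ↦ ?_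
    have hin' := Ioo_subset_Icc_self (hin t ht)
    exact variation_pointwise_bound hC hs.le hs1 hAC (hζb t ht) (hη t ht) (hx' t ht)
      (hν' t ht) (ha₀ t ht) (ha₁ t ht) (haA _ (hxin t ht) _ hin') (hbA _ (hxin t ht) _ hin')
  have hcross : ∫ t in (0 : ℝ)..1, (2 * a (x t) * deriv x t * η t + f t * ζ t) =
      ∫ t in (0 : ℝ)..1, (W t - k) ^ 2 := by
    rw [← hm1, intervalIntegral.integral_add (Continuous.intervalIntegrable (by fun_prop) _ _)
      (Continuous.intervalIntegrable (by fun_prop) _ _), hibp, ← sub_eq_add_neg,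
      ← intervalIntegral.integral_sub (Continuous.intervalIntegrable (by fun_prop) _ _)
      (Continuous.intervalIntegrable (by fun_prop) _ _)]
    refine intervalIntegral.integral_congr fun t _ ↦ ?_
    simp only [hηdef, hW]
    ring
  replace hle := hm.trans hle
  rw [intervalIntegral.integral_add (Continuous.intervalIntegrable (by fun_prop) _ _)
    (by simp), intervalIntegral.integral_sub (Continuous.intervalIntegrable (by fun_prop) _ _)
    (Continuous.intervalIntegrable (by fun_prop) _ _), intervalIntegral.integral_const_mul, hcross,
    intervalIntegral.integral_const] at hle
  simp only [sub_zero, one_smul] at hle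
  have hfin : s * ∫ t in (0 : ℝ)..1, (W t - k) ^ 2 ≤
      s * (((∫ t in (0 : ℝ)..1, (a (x t) * deriv x t ^ 2 + b (x t) * ν t ^ 2)) - m) / s +
        s * (9 * C ^ 5)) := by
    rw [mul_add, mul_div_cancel₀ _ hs.ne']
    linarith
  exact le_of_mul_le_mul_left hfin hs

end Variations

/-! ### Arzelà-Ascoli on the unit interval. -/

section Compactness

/-- A form of the Arzelà-Ascoli theorem for functions on `[0, 1]`. -/
theorem exists_subseq_tendsto_of_lipschitzOnWith {β : Type*} [PseudoMetricSpace β] [T2Space β]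
    {K : NNReal} {S : Set β} (hS : IsCompact S) {f : ℕ → ℝ → β}
    (hL : ∀ n, LipschitzOnWith K (f n) (Icc 0 1)) (hfS : ∀ n, ∀ t ∈ Icc (0 : ℝ) 1, f n t ∈ S) :
    ∃ (θ : ℕ → ℕ) (g : ℝ → β), StrictMono θ ∧ Continuous g ∧
      ∀ t, Tendsto (fun n ↦ f (θ n) (projIcc 0 1 zero_le_one t)) atTop (𝓝 (g t)) := by
  let A : Set (BoundedContinuousFunction (Icc (0 : ℝ) 1) β) :=
    {f | LipschitzWith K f ∧ ∀ t, f t ∈ S}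
  have hev : ∀ t, Continuous fun f : BoundedContinuousFunction (Icc (0 : ℝ) 1) β ↦ f t :=
    fun t ↦ continuous_eval_const t
  have hA : IsCompact A := by
    refine BoundedContinuousFunction.arzela_ascoli₂ S hS A ?_ (fun f t hf ↦ hf.2 t) ?_
    · have e : A = (⋂ s, ⋂ t, {f | dist (f s) (f t) ≤ K * dist s t}) ∩ ⋂ t, {f | f t ∈ S} := by
        ext f
        simp only [A, lipschitzWith_iff_dist_le_mul, mem_inter_iff, mem_iInter, mem_ofPred_eq]
      rw [e]
      exact (isClosed_iInter fun s ↦ isClosed_iInter fun t ↦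
          isClosed_le ((hev s).dist (hev t)) continuous_const).inter
        (isClosed_iInter fun t ↦ hS.isClosed.preimage (hev t))
    · exact (LipschitzWith.uniformEquicontinuous _ K fun f ↦ f.2.1).equicontinuous
  let G : ℕ → BoundedContinuousFunction (Icc (0 : ℝ) 1) β := fun n ↦
    BoundedContinuousFunction.mkOfCompact
      ⟨(Icc (0 : ℝ) 1).domRestrict (f n), (hL n).continuousOn.domRestrict⟩
  obtain ⟨g, -, θ, hθ, hg⟩ := hA.tendsto_subseq (x := G)
    fun n ↦ ⟨(hL n).to_restrict, fun t ↦ hfS n t t.2⟩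
  refine ⟨θ, IccExtend zero_le_one g, hθ, g.continuous.Icc_extend',
    fun t ↦ ((hev (projIcc 0 1 zero_le_one t)).tendsto g).comp hg⟩

end Compactness

/-! ### Passage to a `C^1` limit. -/

section Limit

/-- `L¹` convergence implies convergence in measure, hence almost everywhere along a subsequence. -/
theorem exists_subseq_ae_tendsto_zero {h : ℕ → ℝ → ℝ} (hc : ∀ n, Continuous (h n))
    (h0 : ∀ n t, 0 ≤ h n t)
    (hi : Tendsto (fun n ↦ ∫ t in (0 : ℝ)..1, h n t) atTop (𝓝 0)) :
    ∃ θ : ℕ → ℕ, StrictMono θ ∧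
      ∀ᵐ t ∂(volume.restrict (Icc (0 : ℝ) 1)), Tendsto (fun n ↦ h (θ n) t) atTop (𝓝 0) := by
  have hm : TendstoInMeasure (volume.restrict (Icc (0 : ℝ) 1)) h atTop (fun _ ↦ 0) := by
    refine tendstoInMeasure_of_tendsto_eLpNorm (p := 1) one_ne_zero
      (fun n ↦ (hc n).aestronglyMeasurable) aestronglyMeasurable_const ?_
    have e : ∀ n, eLpNorm (h n - fun _ ↦ 0) 1 (volume.restrict (Icc (0 : ℝ) 1)) =
        ENNReal.ofReal (∫ t in (0 : ℝ)..1, h n t) := fun n ↦ by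
      rw [eLpNorm_one_eq_lintegral_enorm, intervalIntegral.integral_of_le zero_le_one,
        ← integral_Icc_eq_integral_Ioc, ofReal_integral_eq_lintegral_ofReal
          (hc n).continuousOn.integrableOn_Icc (ae_of_all _ (h0 n))]
      refine lintegral_congr fun t ↦ ?_
      simp [Real.enorm_of_nonneg (h0 n t)]
    simp only [e]
    simpa using ENNReal.tendsto_ofReal hi
  exact hm.exists_seq_tendsto_ae

theorem tendsto_zero_of_sq_le {p h : ℕ → ℝ} (hp : ∀ n, p n ^ 2 ≤ h n)
    (hh : Tendsto h atTop (𝓝 0)) : Tendsto p atTop (𝓝 0) := by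
  have h1 : Tendsto (fun n ↦ √(h n)) atTop (𝓝 0) := by
    simpa using hh.sqrt
  exact squeeze_zero_norm (fun n ↦ Real.abs_le_sqrt (hp n)) h1

/-- A pointwise limit of `C^1` functions with bounded derivatives that converge almost everywhere
to a continuous function is `C^1`. -/
theorem eq_integral_of_tendsto {x : ℕ → ℝ → ℝ} {x₀ K : ℝ} {X v : ℝ → ℝ}
    (hx : ∀ n, ContDiff ℝ 1 (x n)) (hx0 : ∀ n, x n 0 = x₀)
    (hx' : ∀ n, ∀ t ∈ Icc (0 : ℝ) 1, |deriv (x n) t| ≤ K)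
    (hX : ∀ t ∈ Icc (0 : ℝ) 1, Tendsto (fun n ↦ x n t) atTop (𝓝 (X t)))
    (hv : ∀ᵐ t ∂(volume.restrict (Icc (0 : ℝ) 1)),
      Tendsto (fun n ↦ deriv (x n) t) atTop (𝓝 (v t))) :
    ∀ t ∈ Icc (0 : ℝ) 1, X t = x₀ + ∫ u in (0 : ℝ)..t, v u := by
  intro t ht
  have hsub : uIoc 0 t ⊆ Icc 0 1 := by
    rw [uIoc_of_le ht.1]; exact fun u hu ↦ ⟨hu.1.le, hu.2.trans ht.2⟩
  have h1 : Tendsto (fun n ↦ ∫ u in (0 : ℝ)..t, deriv (x n) u) atTop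
      (𝓝 (∫ u in (0 : ℝ)..t, v u)) := by
    refine intervalIntegral.tendsto_integral_filter_of_dominated_convergence (fun _ ↦ K)
      (Eventually.of_forall fun n ↦ ((hx n).continuous_deriv le_rfl).aestronglyMeasurable)
      (Eventually.of_forall fun n ↦ ae_of_all _ fun u hu ↦ hx' n u (hsub hu)) (by simp) ?_
    rw [ae_restrict_iff' measurableSet_Icc] at hv
    filter_upwards [hv] with u hu hu' using hu (hsub hu')
  have h2 : ∀ n, x n t = x₀ + ∫ u in (0 : ℝ)..t, deriv (x n) u := fun n ↦ by
    rw [intervalIntegral.integral_deriv_eq_sub (fun u _ ↦ (hx n).differentiable one_ne_zero u)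
      (((hx n).continuous_deriv le_rfl).intervalIntegrable _ _), hx0]
    ring
  refine tendsto_nhds_unique (hX t ht) ?_
  simp only [h2]
  exact h1.const_add x₀

theorem lipschitzOnWith_of_abs_deriv_le {x : ℝ → ℝ} (hx : ContDiff ℝ 1 x) {K : NNReal}
    (h : ∀ t ∈ Icc (0 : ℝ) 1, |deriv x t| ≤ K) : LipschitzOnWith K x (Icc 0 1) :=
  (convex_Icc (0 : ℝ) 1).lipschitzOnWith_of_nnnorm_deriv_le
    (fun t _ ↦ hx.differentiable one_ne_zero t) (fun t ht ↦ h t ht)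

/-- A sequence of curves for which the Euler-Lagrange equations of the energy
`∫ a(x) x'² + b(x) φ'²` hold asymptotically subconverges to a `C^1` curve. -/
theorem exists_limit_curve {a b : ℝ → ℝ} (ha : Continuous a) (hb : Continuous b)
    (ha1 : ∀ y, 1 ≤ a y) {δ : ℝ} (hbpos : ∀ y ∈ Icc δ (1 - δ), 0 < b y)
    {x φ F : ℕ → ℝ → ℝ} {c k V : ℕ → ℝ} {x₀ φ₀ E : ℝ} {K : NNReal}
    (hx : ∀ n, ContDiff ℝ 1 (x n)) (hφ : ∀ n, ContDiff ℝ 1 (φ n)) (hF : ∀ n, Continuous (F n))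
    (hxδ : ∀ n, ∀ t ∈ Icc (0 : ℝ) 1, x n t ∈ Icc δ (1 - δ))
    (hx0 : ∀ n, x n 0 = x₀) (hφ0 : ∀ n, φ n 0 = φ₀)
    (hx' : ∀ n, ∀ t ∈ Icc (0 : ℝ) 1, |deriv (x n) t| ≤ K)
    (hφ' : ∀ n, ∀ t ∈ Icc (0 : ℝ) 1, |deriv (φ n) t| ≤ K)
    (hFL : ∀ n, LipschitzOnWith K (F n) (Icc 0 1))
    (hFK : ∀ n, ∀ t ∈ Icc (0 : ℝ) 1, |F n t| ≤ K)
    (hc : ∀ n, |c n| ≤ K) (hk : ∀ n, |k n| ≤ K)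
    (hspeed : ∀ n, ∀ t ∈ Icc (0 : ℝ) 1,
      a (x n t) * deriv (x n) t ^ 2 + b (x n t) * deriv (φ n) t ^ 2 ≤ V n)
    (hV : Tendsto V atTop (𝓝 E))
    (hint : Tendsto (fun n ↦ ∫ t in (0 : ℝ)..1, ((b (x n t) * deriv (φ n) t - c n) ^ 2 +
      (2 * a (x n t) * deriv (x n) t - F n t - k n) ^ 2)) atTop (𝓝 0)) :
    ∃ (θ : ℕ → ℕ) (X Φ : ℝ → ℝ), StrictMono θ ∧ ContDiff ℝ 1 X ∧ ContDiff ℝ 1 Φ ∧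
      (∀ t ∈ Icc (0 : ℝ) 1, Tendsto (fun n ↦ x (θ n) t) atTop (𝓝 (X t))) ∧
      (∀ t ∈ Icc (0 : ℝ) 1, Tendsto (fun n ↦ φ (θ n) t) atTop (𝓝 (Φ t))) ∧
      ∀ t ∈ Icc (0 : ℝ) 1, a (X t) * deriv X t ^ 2 + b (X t) * deriv Φ t ^ 2 ≤ E := by
  have hxL := fun n ↦ lipschitzOnWith_of_abs_deriv_le (hx n) (hx' n)
  have hφL := fun n ↦ lipschitzOnWith_of_abs_deriv_le (hφ n) (hφ' n)
  have bound : ∀ {f : ℝ → ℝ} {y : ℝ}, LipschitzOnWith K f (Icc 0 1) → f 0 = y →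
      ∀ t ∈ Icc (0 : ℝ) 1, f t ∈ Icc (y - K) (y + K) := fun {f y} hf h0 t ht ↦ by
    have h1 := hf.dist_le_mul t ht 0 (left_mem_Icc.2 zero_le_one)
    rw [Real.dist_eq, Real.dist_eq, h0, sub_zero, abs_of_nonneg ht.1] at h1
    have h2 := abs_le.1 (h1.trans (mul_le_of_le_one_right K.2 ht.2))
    constructor <;> linarith [h2.1, h2.2]
  -- The constants `c n` and `k n` ride along as constant functions, so one extraction serves all
  -- five sequences.
  let f : ℕ → ℝ → ℝ × ℝ × ℝ × ℝ × ℝ := fun n t ↦ (x n t, φ n t, F n t, c n, k n)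
  have hfL : ∀ n, LipschitzOnWith K (f n) (Icc 0 1) := fun n ↦ by
    have h1 := (hxL n).prodMk ((hφL n).prodMk ((hFL n).prodMk
      (LipschitzOnWith.of_dist_le_mul (K := K) (f := fun _ : ℝ ↦ (c n, k n)) (s := Icc 0 1)
        fun s _ t _ ↦ by simp; positivity)))
    simpa using h1
  obtain ⟨θ₁, g, hθ₁, hg, hlim⟩ := exists_subseq_tendsto_of_lipschitzOnWith
    (S := Icc (x₀ - K) (x₀ + K) ×ˢ Icc (φ₀ - K) (φ₀ + K) ×ˢ Icc (-K : ℝ) K ×ˢ Icc (-K : ℝ) K ×ˢ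
      Icc (-K : ℝ) K)
    (isCompact_Icc.prod (isCompact_Icc.prod (isCompact_Icc.prod (isCompact_Icc.prod isCompact_Icc))))
    hfL fun n t ht ↦ ⟨bound (hxL n) (hx0 n) t ht, bound (hφL n) (hφ0 n) t ht,
      abs_le.1 (hFK n t ht), abs_le.1 (hc n), abs_le.1 (hk n)⟩
  have hxd := fun n ↦ (hx n).continuous_deriv le_rfl
  have hφd := fun n ↦ (hφ n).continuous_deriv le_rfl
  have hxc := fun n ↦ (hx n).continuous
  obtain ⟨θ₂, hθ₂, hae⟩ := exists_subseq_ae_tendsto_zero (h := fun n t ↦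
      (b (x (θ₁ n) t) * deriv (φ (θ₁ n)) t - c (θ₁ n)) ^ 2 +
      (2 * a (x (θ₁ n) t) * deriv (x (θ₁ n)) t - F (θ₁ n) t - k (θ₁ n)) ^ 2)
    (fun n ↦ by
      have := hxd (θ₁ n); have := hφd (θ₁ n); have := hxc (θ₁ n); have := hF (θ₁ n)
      fun_prop) (fun n t ↦ by positivity) (hint.comp hθ₁.tendsto_atTop)
  set θ := θ₁ ∘ θ₂ with hθ
  have hθm : StrictMono θ := hθ₁.comp hθ₂
  have hlim' : ∀ t, Tendsto (fun n ↦ f (θ n) (projIcc 0 1 zero_le_one t)) atTop (𝓝 (g t)) :=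
    fun t ↦ (hlim t).comp hθ₂.tendsto_atTop
  have hlimI : ∀ t ∈ Icc (0 : ℝ) 1, Tendsto (fun n ↦ f (θ n) t) atTop (𝓝 (g t)) :=
    fun t ht ↦ by simpa [projIcc_of_mem zero_le_one ht] using hlim' t
  have hX0 : ∀ t, (g t).1 ∈ Icc δ (1 - δ) := fun t ↦
    isClosed_Icc.mem_of_tendsto ((continuous_fst.tendsto _).comp (hlim' t))
      (Eventually.of_forall fun n ↦ hxδ _ _ (projIcc 0 1 zero_le_one t).2)
  have lx : ∀ t ∈ Icc (0 : ℝ) 1, Tendsto (fun n ↦ x (θ n) t) atTop (𝓝 (g t).1) := fun t ht ↦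
    (continuous_fst.tendsto _).comp (hlimI t ht)
  have lφ : ∀ t ∈ Icc (0 : ℝ) 1, Tendsto (fun n ↦ φ (θ n) t) atTop (𝓝 (g t).2.1) := fun t ht ↦
    ((continuous_fst.comp continuous_snd).tendsto _).comp (hlimI t ht)
  have lF : ∀ t ∈ Icc (0 : ℝ) 1, Tendsto (fun n ↦ F (θ n) t) atTop (𝓝 (g t).2.2.1) :=
    fun t ht ↦ ((continuous_fst.comp (continuous_snd.comp continuous_snd)).tendsto _).comp
      (hlimI t ht)
  have lc : ∀ t ∈ Icc (0 : ℝ) 1, Tendsto (fun n ↦ c (θ n)) atTop (𝓝 (g t).2.2.2.1) :=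
    fun t ht ↦ ((continuous_fst.comp (continuous_snd.comp (continuous_snd.comp
      continuous_snd))).tendsto _).comp (hlimI t ht)
  have lk : ∀ t ∈ Icc (0 : ℝ) 1, Tendsto (fun n ↦ k (θ n)) atTop (𝓝 (g t).2.2.2.2) :=
    fun t ht ↦ ((continuous_snd.comp (continuous_snd.comp (continuous_snd.comp
      continuous_snd))).tendsto _).comp (hlimI t ht)
  -- The limiting Euler-Lagrange equations solved for the velocities; the divisors are positive
  -- since `a ≥ 1` and the limit stays in the band. The right-hand sides are continuous, which is
  -- the source of `C^1` regularity.
  let vx : ℝ → ℝ := fun t ↦ ((g t).2.2.1 + (g t).2.2.2.2) / (2 * a (g t).1)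
  let vφ : ℝ → ℝ := fun t ↦ (g t).2.2.2.1 / b (g t).1
  have ha0 : ∀ y, 0 < a y := fun y ↦ one_pos.trans_le (ha1 y)
  have hvx : Continuous vx := Continuous.div (by fun_prop) (by fun_prop) fun t ↦
    (mul_pos two_pos (ha0 _)).ne'
  have hvφ : Continuous vφ := Continuous.div (by fun_prop) (by fun_prop) fun t ↦
    (hbpos _ (hX0 t)).ne'
  have hae' : ∀ᵐ t ∂(volume.restrict (Icc (0 : ℝ) 1)),
      Tendsto (fun n ↦ deriv (x (θ n)) t) atTop (𝓝 (vx t)) ∧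
      Tendsto (fun n ↦ deriv (φ (θ n)) t) atTop (𝓝 (vφ t)) := by
    filter_upwards [hae, self_mem_ae_restrict measurableSet_Icc] with t ht hI
    have hp : Tendsto (fun n ↦ b (x (θ n) t) * deriv (φ (θ n)) t - c (θ n)) atTop (𝓝 0) :=
      tendsto_zero_of_sq_le (fun n ↦ le_add_of_nonneg_right (sq_nonneg _)) ht
    have hq : Tendsto (fun n ↦ 2 * a (x (θ n) t) * deriv (x (θ n)) t - F (θ n) t - k (θ n))
        atTop (𝓝 0) :=
      tendsto_zero_of_sq_le (fun n ↦ le_add_of_nonneg_left (sq_nonneg _)) ht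
    have hat := (ha.tendsto _).comp (lx t hI)
    have hbt := (hb.tendsto _).comp (lx t hI)
    constructor
    · have h1 := (hq.add ((lF t hI).add (lk t hI))).div (hat.const_mul 2)
        (mul_pos two_pos (ha0 _)).ne'
      rw [zero_add] at h1
      refine h1.congr fun n ↦ ?_
      have := (ha0 (x (θ n) t)).ne'
      simp only [Pi.div_apply, Function.comp_apply]
      field_simp
      ring
    · have h1 := (hp.add (lc t hI)).div hbt (hbpos _ (hX0 t)).ne'
      rw [zero_add] at h1
      refine h1.congr fun n ↦ ?_
      have := (hbpos _ (hxδ (θ n) t hI)).ne'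
      simp only [Pi.div_apply, Function.comp_apply]
      field_simp
      ring
  have eX := eq_integral_of_tendsto (fun n ↦ hx (θ n)) (fun n ↦ hx0 _) (fun n ↦ hx' _) lx
    (hae'.mono fun t h ↦ h.1)
  have eΦ := eq_integral_of_tendsto (fun n ↦ hφ (θ n)) (fun n ↦ hφ0 _) (fun n ↦ hφ' _) lφ
    (hae'.mono fun t h ↦ h.2)
  refine ⟨θ, fun t ↦ x₀ + ∫ u in (0 : ℝ)..t, vx u, fun t ↦ φ₀ + ∫ u in (0 : ℝ)..t, vφ u, hθm,
    contDiff_one_integral hvx _, contDiff_one_integral hvφ _,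
    fun t ht ↦ by beta_reduce; rw [← eX t ht]; exact lx t ht,
    fun t ht ↦ by beta_reduce; rw [← eΦ t ht]; exact lφ t ht, fun t ht ↦ ?_⟩
  beta_reduce
  rw [(hasDerivAt_const_add_integral hvx x₀ t).deriv,
    (hasDerivAt_const_add_integral hvφ φ₀ t).deriv, ← eX t ht]
  set G : ℝ → ℝ := fun t ↦ a (g t).1 * vx t ^ 2 + b (g t).1 * vφ t ^ 2 with hG
  have hGc : Continuous G := by fun_prop
  -- The inequality `G ≤ E` is written as the equality `max G E = E`, so that two continuous
  -- functions equal almost everywhere are equal everywhere on the interval.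
  have hGae : (fun t ↦ max (G t) E) =ᵐ[volume.restrict (Icc (0 : ℝ) 1)] fun _ ↦ E := by
    filter_upwards [hae', self_mem_ae_restrict measurableSet_Icc] with u hu hI
    refine max_eq_right (le_of_tendsto_of_tendsto'
      ((((ha.tendsto _).comp (lx u hI)).mul (hu.1.pow 2)).add
        (((hb.tendsto _).comp (lx u hI)).mul (hu.2.pow 2)))
      (hV.comp hθm.tendsto_atTop) fun n ↦ hspeed (θ n) u hI)
  have := Measure.eqOn_Icc_of_ae_eq volume zero_ne_one hGae
    (hGc.max continuous_const).continuousOn continuousOn_const ht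
  exact max_eq_right_iff.1 this

end Limit

/-! ### Existence of `C^1` minimizing curves. -/

section Minimizers

/-- Quantitative Euler-Lagrange equations for almost minimizers of the energy
`∫ a(x) x'² + b(x) φ'²`. -/
theorem exists_almost_eulerLagrange {a b : ℝ → ℝ} (ha : ContDiff ℝ 2 a) (hb : ContDiff ℝ 2 b)
    {A K δ : ℝ} (hA : 1 ≤ A) (hK : 1 ≤ K)
    (haA : ∀ y ∈ Icc (0 : ℝ) 1, |a y| ≤ A) (hbA : ∀ y ∈ Icc (0 : ℝ) 1, |b y| ≤ A)
    (ha'A : ∀ y ∈ Icc (0 : ℝ) 1, |deriv a y| ≤ A) (hb'A : ∀ y ∈ Icc (0 : ℝ) 1, |deriv b y| ≤ A)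
    (haT : ∀ y ∈ Icc (0 : ℝ) 1, ∀ h, y + h ∈ Icc (0 : ℝ) 1 →
        a (y + h) ≤ a y + deriv a y * h + A * h ^ 2)
    (hbT : ∀ y ∈ Icc (0 : ℝ) 1, ∀ h, y + h ∈ Icc (0 : ℝ) 1 →
        b (y + h) ≤ b y + deriv b y * h + A * h ^ 2)
    {x φ : ℝ → ℝ} (hx : ContDiff ℝ 1 x) (hφ : ContDiff ℝ 1 φ)
    (hxδ : ∀ t ∈ Icc (0 : ℝ) 1, x t ∈ Icc δ (1 - δ))
    (hx' : ∀ t ∈ Icc (0 : ℝ) 1, |deriv x t| ≤ K) (hφ' : ∀ t ∈ Icc (0 : ℝ) 1, |deriv φ t| ≤ K)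
    {m κ : ℝ} (hκ : 0 < κ) (hκ1 : √κ ≤ 1) (hκδ : √κ * (8 * A * K ^ 2) < δ)
    (hE : (∫ t in (0 : ℝ)..1, (a (x t) * deriv x t ^ 2 + b (x t) * deriv φ t ^ 2)) ≤ m + κ)
    (hmin : ∀ ξ ψ : ℝ → ℝ, ContDiff ℝ 1 ξ → ContDiff ℝ 1 ψ → ξ 0 = 0 → ξ 1 = 0 → ψ 0 = 0 →
      ψ 1 = 0 → (∀ t ∈ Icc (0 : ℝ) 1, x t + ξ t ∈ Ioo (0 : ℝ) 1) →
      m ≤ ∫ t in (0 : ℝ)..1, (a (x t + ξ t) * (deriv x t + deriv ξ t) ^ 2 +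
        b (x t + ξ t) * (deriv φ t + deriv ψ t) ^ 2)) :
    ∃ (F : ℝ → ℝ) (c k : ℝ), Continuous F ∧
      LipschitzOnWith (8 * A * K ^ 2).toNNReal F (Icc 0 1) ∧
      (∀ t ∈ Icc (0 : ℝ) 1, |F t| ≤ 8 * A * K ^ 2) ∧ |c| ≤ 8 * A * K ^ 2 ∧ |k| ≤ 8 * A * K ^ 2 ∧
      ∫ t in (0 : ℝ)..1, ((b (x t) * deriv φ t - c) ^ 2 +
        (2 * a (x t) * deriv x t - F t - k) ^ 2) ≤
        A * κ + √κ * (1 + 9 * (8 * A * K ^ 2) ^ 5) := by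
  have hδ : 0 < δ := lt_of_le_of_lt (by positivity) hκδ
  have hsκ : 0 < √κ := Real.sqrt_pos.2 hκ
  have hac := ha.continuous
  have hbc := hb.continuous
  have hxc := hx.continuous
  have hxd := hx.continuous_deriv le_rfl
  have hφd := hφ.continuous_deriv le_rfl
  have had : Continuous (deriv a) := ha.continuous_deriv (by simp)
  have hbd : Continuous (deriv b) := hb.continuous_deriv (by simp)
  have hxI : ∀ t ∈ Icc (0 : ℝ) 1, x t ∈ Ioo (0 : ℝ) 1 := fun t ht ↦ by
    constructor <;> linarith [(hxδ t ht).1, (hxδ t ht).2]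
  have hxI' : ∀ t ∈ Icc (0 : ℝ) 1, x t ∈ Icc (0 : ℝ) 1 := fun t ht ↦ Ioo_subset_Icc_self (hxI t ht)
  have int_bound : ∀ {f : ℝ → ℝ} {R : ℝ}, 0 ≤ R → (∀ t ∈ Icc (0 : ℝ) 1, |f t| ≤ R) →
      ∀ t ∈ Icc (0 : ℝ) 1, |∫ u in (0 : ℝ)..t, f u| ≤ R := fun {f R} hR hf t ht ↦ by
    have := intervalIntegral.norm_integral_le_of_norm_le_const (a := 0) (b := t) (f := f) (C := R)
      (fun u hu ↦ by
        rw [uIoc_of_le ht.1] at hu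
        exact hf u ⟨hu.1.le, hu.2.trans ht.2⟩)
    rw [Real.norm_eq_abs, sub_zero, abs_of_nonneg ht.1] at this
    exact this.trans (mul_le_of_le_one_right hR ht.2)
  have hAK : 1 ≤ A * K ^ 2 := one_le_mul_of_one_le_of_one_le hA (one_le_pow₀ hK)
  have hKK : A * K ≤ A * K ^ 2 := by
    have := le_self_pow₀ hK two_ne_zero
    gcongr
  set f : ℝ → ℝ := fun u ↦ deriv a (x u) * deriv x u ^ 2 + deriv b (x u) * deriv φ u ^ 2 with hf
  have hfc : Continuous f := by fun_prop
  have hfb : ∀ t ∈ Icc (0 : ℝ) 1, |f t| ≤ 2 * (A * K ^ 2) := fun t ht ↦ by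
    refine (abs_add_le _ _).trans ?_
    rw [abs_mul, abs_mul, abs_pow, abs_pow]
    have h1 : |deriv a (x t)| * |deriv x t| ^ 2 ≤ A * K ^ 2 :=
      mul_le_mul (ha'A _ (hxI' t ht)) (pow_le_pow_left₀ (abs_nonneg _) (hx' t ht) 2)
        (by positivity) (by positivity)
    have h2 : |deriv b (x t)| * |deriv φ t| ^ 2 ≤ A * K ^ 2 :=
      mul_le_mul (hb'A _ (hxI' t ht)) (pow_le_pow_left₀ (abs_nonneg _) (hφ' t ht) 2)
        (by positivity) (by positivity)
    linarith
  set F : ℝ → ℝ := fun t ↦ ∫ u in (0 : ℝ)..t, f u with hF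
  have hF1 : ContDiff ℝ 1 F := by simpa using contDiff_one_integral hfc 0
  have hFc : Continuous F := hF1.continuous
  have hFd : ∀ t, deriv F t = f t := fun t ↦ (hfc.integral_hasStrictDerivAt 0 t).hasDerivAt.deriv
  have hFb : ∀ t ∈ Icc (0 : ℝ) 1, |F t| ≤ 2 * (A * K ^ 2) := int_bound (by positivity) hfb
  set W : ℝ → ℝ := fun t ↦ 2 * a (x t) * deriv x t - F t with hW
  -- Source of the constant `8 A K²`: `W` and its mean `k` are each at most `4 A K²`, so `W - k` is
  -- at most twice that.
  have hWb : ∀ t ∈ Icc (0 : ℝ) 1, |W t| ≤ 4 * (A * K ^ 2) := fun t ht ↦ by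
    have h1 : |2 * a (x t) * deriv x t| ≤ 2 * A * K := by
      rw [abs_mul, abs_mul, abs_two]
      have := haA _ (hxI' t ht)
      have := hx' t ht
      gcongr
    have := abs_sub (2 * a (x t) * deriv x t) (F t)
    linarith [hFb t ht]
  have hPb : ∀ t ∈ Icc (0 : ℝ) 1, |b (x t) * deriv φ t| ≤ A * K := fun t ht ↦ by
    rw [abs_mul]
    exact mul_le_mul (hbA _ (hxI' t ht)) (hφ' t ht) (abs_nonneg _) (by positivity)
  have h1I : (1 : ℝ) ∈ Icc (0 : ℝ) 1 := right_mem_Icc.2 zero_le_one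
  have hkb := int_bound (by positivity) hWb 1 h1I
  have hcb := int_bound (by positivity) hPb 1 h1I
  set k := ∫ t in (0 : ℝ)..1, W t with hk
  set c := ∫ t in (0 : ℝ)..1, b (x t) * deriv φ t with hc
  have hKC : K ≤ 8 * A * K ^ 2 := by
    have : K ≤ A * K := le_mul_of_one_le_left (by positivity) hA
    linarith
  have hAC : A ≤ 8 * A * K ^ 2 := by
    have : A ≤ A * K ^ 2 := le_mul_of_one_le_right (by positivity) (one_le_pow₀ hK)
    linarith
  have I1 : ∫ t in (0 : ℝ)..1, (b (x t) * deriv φ t - c) ^ 2 ≤ A * κ := by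
    have := integral_sq_momentum_sub_mean_le (α := fun t ↦ a (x t) * deriv x t ^ 2)
      (β := fun t ↦ b (x t)) (ν := deriv φ) (B := A) (m := m) (by fun_prop) (by fun_prop) hφd
      (by positivity) (fun t ht ↦ (le_abs_self _).trans (hbA _ (hxI' t ht))) fun η hη hη0 ↦ by
        have hψ : ContDiff ℝ 1 fun t ↦ ∫ u in (0 : ℝ)..t, η u := by
          simpa using contDiff_one_integral hη 0
        have hψd : ∀ t, deriv (fun t ↦ ∫ u in (0 : ℝ)..t, η u) t = η t := fun t ↦
          (hη.integral_hasStrictDerivAt 0 t).hasDerivAt.deriv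
        have := hmin (fun _ ↦ 0) _ contDiff_const hψ rfl rfl (by simp) hη0
          (fun t ht ↦ by simpa using hxI t ht)
        simpa [hψd] using this
    refine this.trans (mul_le_mul_of_nonneg_left ?_ (by positivity))
    linarith
  have I2 : ∫ t in (0 : ℝ)..1, (W t - k) ^ 2 ≤ √κ * (1 + 9 * (8 * A * K ^ 2) ^ 5) := by
    -- The step size `√κ` balances the two errors `κ / s` and `9 C^5 s`.
    have := integral_sq_eulerLagrange_le ha hb hx hφd (A := A) (C := 8 * A * K ^ 2) (s := √κ)
      (m := m) (δ := δ) (by linarith) hsκ hκ1 hAC hκδ haT hbT hxδ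
      (fun t ht ↦ (hx' t ht).trans hKC) (fun t ht ↦ (hφ' t ht).trans hKC)
      (fun t ht ↦ (haA _ (hxI' t ht)).trans hAC) (fun t ht ↦ (ha'A _ (hxI' t ht)).trans hAC)
      (F := F) (W := W) (k := k) rfl rfl rfl
      (fun t ht ↦ by
        have := abs_sub (W t) k
        linarith [hWb t ht])
      fun ξ hξ h0 h1 hI ↦ by
        have := hmin ξ (fun _ ↦ 0) hξ contDiff_const h0 h1 rfl rfl hI
        simpa using this
    refine this.trans ?_
    have e : κ / √κ = √κ := Real.div_sqrt
    have e2 : ((∫ t in (0 : ℝ)..1, (a (x t) * deriv x t ^ 2 + b (x t) * deriv φ t ^ 2)) - m) / √κ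
        ≤ κ / √κ := div_le_div_of_nonneg_right (by linarith) hsκ.le
    rw [e] at e2
    linarith
  refine ⟨F, c, k, hFc, ?_, fun t ht ↦ (hFb t ht).trans (by linarith), hcb.trans (by linarith),
    hkb.trans (by linarith), ?_⟩
  · refine lipschitzOnWith_of_abs_deriv_le hF1 fun t ht ↦ ?_
    rw [hFd, Real.coe_toNNReal _ (by positivity)]
    exact (hfb t ht).trans (by linarith)
  · have hWc : Continuous W := by fun_prop
    have := intervalIntegral.integral_add (μ := volume) (a := (0 : ℝ)) (b := 1)
      (f := fun t ↦ (b (x t) * deriv φ t - c) ^ 2) (g := fun t ↦ (W t - k) ^ 2)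
      (Continuous.intervalIntegrable (by fun_prop) _ _)
      (Continuous.intervalIntegrable (by fun_prop) _ _)
    exact this.trans_le (add_le_add I1 I2)

variable (r : ℝ → ℝ) (hr : ContDiff ℝ ∞ r) (hpos : ∀ x ∈ Ioo (0 : ℝ) 1, 0 < r x)

/-- Almost minimizing curves of almost constant speed. -/
theorem exists_curve_speed_le (p q : RevSurface) {c : ℝ} (hc : revDist r hr hpos p q < c) :
    ∃ x φ : ℝ → ℝ, ContDiff ℝ 1 x ∧ ContDiff ℝ 1 φ ∧ (∀ t, x t ∈ Ioo (0 : ℝ) 1) ∧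
      φ 0 = Complex.arg p.2 ∧ revCurve x φ 0 = p ∧ revCurve x φ 1 = q ∧
      ∀ t, revSpeedSq r (x t) (deriv x t) (deriv φ t) ≤ c ^ 2 := by
  have h : revEDist r hr hpos p q < ENNReal.ofReal c := by
    rw [← ofReal_revDist]
    exact (ENNReal.ofReal_lt_ofReal_iff ((revDist_nonneg r hr hpos p q).trans_lt hc)).2 hc
  obtain ⟨γ, e0, e1, hγ, hlen⟩ := exists_curve_of_revEDist_lt r hr hpos h
  -- Fixing the initial angle keeps the lifts of a minimizing sequence in a compact set.
  obtain ⟨x, φ, hx, hφ, hI, hφ0, rfl⟩ := exists_eq_revCurve hγ (φ₀ := Complex.arg p.2)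
    (by rw [e0, Circle.exp_arg])
  have hlen' : ∫ t in (0 : ℝ)..1, √(revSpeedSq r (x t) (deriv x t) (deriv φ t)) < c := by
    have e : ∀ t, (revMetric r hr hpos).inner (revCurve x φ t)
        (mfderiv 𝓘(ℝ, ℝ) revModel (revCurve x φ) t (1 : ℝ))
        (mfderiv 𝓘(ℝ, ℝ) revModel (revCurve x φ) t (1 : ℝ)) =
        revSpeedSq r (x t) (deriv x t) (deriv φ t) := fun t ↦ by
      have := revMetric_inner_revCurve r hr hpos (mem_univ t) uniqueDiffWithinAt_univ hx hφ
        fun t _ ↦ hI t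
      rwa [mfderivWithin_univ] at this
    simp only [e] at hlen
    rw [← ofReal_integral_eq_lintegral_ofReal
      ((continuous_revSpeedSq_curve hr hx hφ).sqrt.continuousOn.integrableOn_Icc)
      (ae_of_all _ fun _ ↦ Real.sqrt_nonneg _)] at hlen
    rw [intervalIntegral.integral_of_le zero_le_one, ← integral_Icc_eq_integral_Ioc]
    exact (ENNReal.ofReal_lt_ofReal_iff_of_nonneg
      (integral_nonneg fun _ ↦ Real.sqrt_nonneg _)).1 hlen
  obtain ⟨X, Φ, hX, hΦ, X0, X1, Φ0, Φ1, hr', hs⟩ := exists_reparametrization hr hx hφ hlen'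
  refine ⟨X, Φ, hX, hΦ, fun t ↦ ?_, Φ0.trans hφ0, ?_, ?_, hs⟩
  · obtain ⟨u, hu⟩ := hr' t
    exact hu ▸ hI u
  · rw [← e0]; simp only [revCurve, X0, Φ0]
  · rw [← e1]; simp only [revCurve, X1, Φ1]

/-- The energy of a curve is at least the square of the distance of its endpoints. -/
theorem sq_revDist_le_energy {x φ : ℝ → ℝ} (hx : ContDiff ℝ 1 x)
    (hφ : ContDiff ℝ 1 φ) (h : ∀ t ∈ Icc (0 : ℝ) 1, x t ∈ Ioo (0 : ℝ) 1) :
    revDist r hr hpos (revCurve x φ 0) (revCurve x φ 1) ^ 2 ≤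
      ∫ t in (0 : ℝ)..1, revSpeedSq r (x t) (deriv x t) (deriv φ t) := by
  have h1 := revDist_revCurve_le r hr hpos zero_le_one hx hφ h
  set v : ℝ → ℝ := fun t ↦ √(revSpeedSq r (x t) (deriv x t) (deriv φ t)) with hv
  have hvc : Continuous v := (continuous_revSpeedSq_curve hr hx hφ).sqrt
  set l := ∫ t in (0 : ℝ)..1, v t with hl
  have h2 : ∫ t in (0 : ℝ)..1, revSpeedSq r (x t) (deriv x t) (deriv φ t) =
      ∫ t in (0 : ℝ)..1, v t ^ 2 :=
    intervalIntegral.integral_congr fun t _ ↦ (Real.sq_sqrt (revSpeedSq_nonneg r _ _ _)).symm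
  -- Cauchy-Schwarz, in the form that the variance of the speed is nonnegative.
  have h3 : 0 ≤ ∫ t in (0 : ℝ)..1, (v t - l) ^ 2 :=
    intervalIntegral.integral_nonneg zero_le_one fun _ _ ↦ sq_nonneg _
  have h4 : ∫ t in (0 : ℝ)..1, (v t - l) ^ 2 =
      ∫ t in (0 : ℝ)..1, (v t ^ 2 - 2 * l * v t + l ^ 2) :=
    intervalIntegral.integral_congr fun t _ ↦ by ring
  rw [h4, intervalIntegral.integral_add (Continuous.intervalIntegrable (by fun_prop) _ _) (by simp),
    intervalIntegral.integral_sub (Continuous.intervalIntegrable (by fun_prop) _ _)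
      (Continuous.intervalIntegrable (by fun_prop) _ _), intervalIntegral.integral_const_mul, ← hl,
    intervalIntegral.integral_const] at h3
  simp only [sub_zero, one_smul] at h3
  rw [h2]
  have := pow_le_pow_left₀ (revDist_nonneg r hr hpos _ _) h1 2
  linarith

/-- Any two points of the surface are joined by a `C^1` curve `[0, 1] → Σ` of speed at most
their distance. -/
theorem exists_minimizing_curve (h0 : r 0 = 0) (h1 : r 1 = 0)
    (hd0 : |deriv r 0| < 1 / (2 * Real.pi)) (hd1 : |deriv r 1| < 1 / (2 * Real.pi))
    (p q : RevSurface) :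
    ∃ x φ : ℝ → ℝ, ContDiff ℝ 1 x ∧ ContDiff ℝ 1 φ ∧
      (∀ t ∈ Icc (0 : ℝ) 1, x t ∈ Ioo (0 : ℝ) 1) ∧ revCurve x φ 0 = p ∧ revCurve x φ 1 = q ∧
      ∀ t ∈ Icc (0 : ℝ) 1,
        revSpeedSq r (x t) (deriv x t) (deriv φ t) ≤ revDist r hr hpos p q ^ 2 := by
  obtain ⟨δ, hδ, g, hg, hconf⟩ := exists_confinement r hr hpos h0 h1 hd0 hd1 p q
  set D := revDist r hr hpos p q with hD
  have hD0 : 0 ≤ D := revDist_nonneg r hr hpos p q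
  set a : ℝ → ℝ := fun y ↦ 1 + deriv r y ^ 2 with ha_def
  set b : ℝ → ℝ := fun y ↦ r y ^ 2 with hb_def
  have hr' : ContDiff ℝ 2 (deriv r) :=
    ((contDiff_succ_iff_deriv (n := 2)).1 (hr.of_le (by norm_cast))).2.2
  have ha : ContDiff ℝ 2 a := contDiff_const.add (hr'.pow 2)
  have hb : ContDiff ℝ 2 b := (hr.of_le (by norm_cast)).pow 2
  have ha1 : ∀ y, 1 ≤ a y := fun y ↦ le_add_of_nonneg_right (sq_nonneg _)
  have hIoo : ∀ y ∈ Icc δ (1 - δ), y ∈ Ioo (0 : ℝ) 1 := fun y hy ↦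
    ⟨by linarith [hy.1], by linarith [hy.2]⟩
  have hbpos : ∀ y ∈ Icc δ (1 - δ), 0 < b y := fun y hy ↦ pow_pos (hpos y (hIoo y hy)) 2
  obtain ⟨A₁, hA₁, a1, a2, a3⟩ := exists_taylor_bound ha
  obtain ⟨A₂, hA₂, b1, b2, b3⟩ := exists_taylor_bound hb
  set A := max A₁ A₂
  have hA1 : A₁ ≤ A := le_max_left _ _
  have hA2 : A₂ ≤ A := le_max_right _ _
  obtain ⟨β, hβ, hβb⟩ : ∃ β > 0, ∀ y ∈ Icc δ (1 - δ), β ≤ b y :=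
    isCompact_Icc.exists_forall_le' hb.continuous.continuousOn hbpos
  set K := max 1 (max (√(D ^ 2 + 1)) (√((D ^ 2 + 1) / β))) with hKdef
  have hK1 : 1 ≤ K := le_max_left _ _
  have hK2 : √(D ^ 2 + 1) ≤ K := (le_max_left _ _).trans (le_max_right _ _)
  have hK3 : √((D ^ 2 + 1) / β) ≤ K := (le_max_right _ _).trans (le_max_right _ _)
  set C := 8 * A * K ^ 2 with hC
  have hApos : 0 < A := by linarith
  have hCpos : 0 < C := by positivity
  -- The single parameter `s` bounds every `√κ n`: `s C < δ` keeps the competitors on the surface,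
  -- and `s < g` makes the curves short enough for confinement, as `√(D² + s²) ≤ D + s`.
  obtain ⟨s, hs, hs1⟩ : ∃ s, 0 < s ∧ s < min 1 (min (δ / C) g) :=
    exists_between (lt_min one_pos (lt_min (div_pos hδ hCpos) hg))
  have hs_one : s < 1 := hs1.trans_le (min_le_left _ _)
  have hsδ : s * C < δ := by
    rw [← lt_div_iff₀ hCpos]
    exact hs1.trans_le ((min_le_right _ _).trans (min_le_left _ _))
  have hsg : s < g := hs1.trans_le ((min_le_right _ _).trans (min_le_right _ _))
  let κ : ℕ → ℝ := fun n ↦ s ^ 2 / (n + 1)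
  have hκ : ∀ n, 0 < κ n := fun n ↦ by positivity
  have hκs : ∀ n, κ n ≤ s ^ 2 := fun n ↦ div_le_self (by positivity) (by linarith [n.cast_nonneg (α := ℝ)])
  have hsκ : ∀ n, √(κ n) ≤ s := fun n ↦ Real.sqrt_le_iff.2 ⟨hs.le, hκs n⟩
  have hκ0 : Tendsto κ atTop (𝓝 0) := by
    have := (tendsto_one_div_add_atTop_nhds_zero_nat (𝕜 := ℝ)).const_mul (s ^ 2)
    simpa [κ, div_eq_mul_inv] using this
  have hκ1 : ∀ n, κ n ≤ 1 := fun n ↦ (hκs n).trans (pow_le_one₀ hs.le hs_one.le)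
  have hsq : ∀ n, √(D ^ 2 + κ n) ^ 2 = D ^ 2 + κ n := fun n ↦
    Real.sq_sqrt (by have := hκ n; positivity)
  have hex : ∀ n, D < √(D ^ 2 + κ n) := fun n ↦ Real.lt_sqrt_of_sq_lt (by linarith [hκ n])
  choose x φ hx hφ hI hφ0 e0 e1 hspeed using fun n ↦
    exists_curve_speed_le r hr hpos p q (hex n)
  simp only [hsq] at hspeed
  have hxδ : ∀ n, ∀ t ∈ Icc (0 : ℝ) 1, x n t ∈ Icc δ (1 - δ) := fun n ↦ by
    refine hconf (x n) (φ n) (hx n) (hφ n) (hI n) (e0 n) (e1 n) ?_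
    have hle : ∫ t in (0 : ℝ)..1, √(revSpeedSq r (x n t) (deriv (x n) t) (deriv (φ n) t)) ≤
        ∫ _ in (0 : ℝ)..1, √(D ^ 2 + s ^ 2) :=
      intervalIntegral.integral_mono_on zero_le_one
        ((continuous_revSpeedSq_curve hr (hx n) (hφ n)).sqrt.intervalIntegrable _ _) (by simp)
        fun t _ ↦ Real.sqrt_le_sqrt ((hspeed n t).trans (by linarith [hκs n]))
    simp only [intervalIntegral.integral_const, sub_zero, one_smul] at hle
    have : √(D ^ 2 + s ^ 2) ≤ D + s := Real.sqrt_le_iff.2 ⟨by linarith, by nlinarith⟩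
    linarith
  have hV : ∀ n t, revSpeedSq r (x n t) (deriv (x n) t) (deriv (φ n) t) ≤ D ^ 2 + 1 := fun n t ↦
    (hspeed n t).trans (by linarith [hκ1 n])
  have hx' : ∀ n, ∀ t ∈ Icc (0 : ℝ) 1, |deriv (x n) t| ≤ K := fun n t ht ↦
    (Real.abs_le_sqrt ((sq_le_revSpeedSq r _ _ _).trans (hV n t))).trans hK2
  -- A speed bound controls `φ'` only where `r` is bounded away from zero, hence the need for the
  -- band.
  have hφ' : ∀ n, ∀ t ∈ Icc (0 : ℝ) 1, |deriv (φ n) t| ≤ K := fun n t ht ↦ by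
    refine (Real.abs_le_sqrt ?_).trans hK3
    rw [le_div_iff₀ hβ, mul_comm]
    have h2 : b (x n t) * deriv (φ n) t ^ 2 ≤ D ^ 2 + 1 := by
      refine le_trans ?_ (hV n t)
      unfold revSpeedSq
      exact le_add_of_nonneg_left (by positivity)
    exact (mul_le_mul_of_nonneg_right (hβb _ (hxδ n t ht)) (sq_nonneg _)).trans h2
  choose F c k hF hFL hFb hc hk hint using fun n ↦ exists_almost_eulerLagrange ha hb
    (hA₁.trans hA1) hK1
    (fun y hy ↦ (a1 y hy).trans hA1) (fun y hy ↦ (b1 y hy).trans hA2)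
    (fun y hy ↦ (a2 y hy).trans hA1) (fun y hy ↦ (b2 y hy).trans hA2)
    (fun y hy h hh ↦ (a3 y hy h hh).trans (by gcongr))
    (fun y hy h hh ↦ (b3 y hy h hh).trans (by gcongr))
    (hx n) (hφ n) (hxδ n) (hx' n) (hφ' n) (m := D ^ 2) (hκ n) ((hsκ n).trans hs_one.le)
    ((mul_le_mul_of_nonneg_right (hsκ n) hCpos.le).trans_lt hsδ)
    (by
      have := intervalIntegral.integral_mono_on zero_le_one
        ((continuous_revSpeedSq_curve hr (hx n) (hφ n)).intervalIntegrable _ _)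
        (intervalIntegrable_const (μ := volume)) fun t _ ↦ hspeed n t
      simp only [intervalIntegral.integral_const, sub_zero, one_smul] at this
      exact this)
    (fun ξ ψ hξ hψ ξ0 ξ1 ψ0 ψ1 hin ↦ by
      have := sq_revDist_le_energy r hr hpos ((hx n).add hξ) ((hφ n).add hψ) hin
      have f0 : revCurve (fun t ↦ x n t + ξ t) (fun t ↦ φ n t + ψ t) 0 = p := by
        rw [← e0 n]; simp [revCurve, ξ0, ψ0]
      have f1 : revCurve (fun t ↦ x n t + ξ t) (fun t ↦ φ n t + ψ t) 1 = q := by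
        rw [← e1 n]; simp [revCurve, ξ1, ψ1]
      have d1 : ∀ t, deriv (fun t ↦ x n t + ξ t) t = deriv (x n) t + deriv ξ t := fun t ↦
        deriv_fun_add ((hx n).differentiable one_ne_zero t) (hξ.differentiable one_ne_zero t)
      have d2 : ∀ t, deriv (fun t ↦ φ n t + ψ t) t = deriv (φ n) t + deriv ψ t := fun t ↦
        deriv_fun_add ((hφ n).differentiable one_ne_zero t) (hψ.differentiable one_ne_zero t)
      rw [f0, f1] at this
      simp only [d1, d2] at this
      exact this)
  have hKC : K ≤ C := by
    have : K ≤ K ^ 2 := le_self_pow₀ hK1 two_ne_zero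
    have : K ^ 2 ≤ A * K ^ 2 := le_mul_of_one_le_left (by positivity) (hA₁.trans hA1)
    have : 0 ≤ A * K ^ 2 := by positivity
    linarith
  have hCc : (C.toNNReal : ℝ) = C := Real.coe_toNNReal _ hCpos.le
  have xend : ∀ n, x n 0 = p.1 ∧ x n 1 = q.1 := fun n ↦ by
    constructor
    · rw [← e0 n]; exact (coe_toUnitIoo (hI n 0)).symm
    · rw [← e1 n]; exact (coe_toUnitIoo (hI n 1)).symm
  obtain ⟨θ, X, Φ, -, hX, hΦ, lX, lΦ, hfin⟩ := exists_limit_curve ha.continuous hb.continuous ha1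
    hbpos (K := C.toNNReal) (V := fun n ↦ D ^ 2 + κ n) (E := D ^ 2) hx hφ hF hxδ
    (fun n ↦ (xend n).1) hφ0
    (fun n t ht ↦ by rw [hCc]; exact (hx' n t ht).trans hKC)
    (fun n t ht ↦ by rw [hCc]; exact (hφ' n t ht).trans hKC) hFL
    (fun n t ht ↦ by rw [hCc]; exact hFb n t ht) (fun n ↦ by rw [hCc]; exact hc n)
    (fun n ↦ by rw [hCc]; exact hk n) (fun n t _ ↦ hspeed n t)
    (by simpa using hκ0.const_add (D ^ 2))
    (squeeze_zero (fun n ↦ intervalIntegral.integral_nonneg zero_le_one fun t _ ↦ by positivity)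
      hint (by simpa using (hκ0.const_mul A).add (hκ0.sqrt.mul_const (1 + 9 * C ^ 5))))
  have h0I : (0 : ℝ) ∈ Icc (0 : ℝ) 1 := left_mem_Icc.2 zero_le_one
  have h1I : (1 : ℝ) ∈ Icc (0 : ℝ) 1 := right_mem_Icc.2 zero_le_one
  -- The final angles may differ by multiples of `2π`; only their exponentials are fixed, and this
  -- passes to the limit.
  have angle : ∀ t ∈ Icc (0 : ℝ) 1, ∀ z : Circle, (∀ n, Circle.exp (φ n t) = z) →
      Circle.exp (Φ t) = z := fun t ht z hz ↦ by
    refine tendsto_nhds_unique ((Circle.exp.continuous.tendsto _).comp (lΦ t ht)) ?_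
    simp only [Function.comp_def, hz]
    exact tendsto_const_nhds
  refine ⟨X, Φ, hX, hΦ, fun t ht ↦ hIoo _ (isClosed_Icc.mem_of_tendsto (lX t ht)
    (Eventually.of_forall fun n ↦ hxδ _ t ht)), revCurve_eq ?_ ?_, revCurve_eq ?_ ?_, hfin⟩
  · refine tendsto_nhds_unique (lX 0 h0I) ?_
    simp only [(xend _).1]
    exact tendsto_const_nhds
  · exact angle 0 h0I _ fun n ↦ congrArg Prod.snd (e0 n)
  · refine tendsto_nhds_unique (lX 1 h1I) ?_
    simp only [(xend _).2]
    exact tendsto_const_nhds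
  · exact angle 1 h1I _ fun n ↦ congrArg Prod.snd (e1 n)

end Minimizers

/-! ### Causal curves of the static spacetime. -/

section Causality

variable (r : ℝ → ℝ) (hr : ContDiff ℝ ∞ r) (hpos : ∀ x ∈ Ioo (0 : ℝ) 1, 0 < r x)

/-- The product of `v` with `∂_t` is `-v.1`, so the half-cone condition says `0 < v.1` and already
forces `v ≠ 0`. -/
theorem isFutureCausal_staticSpacetime_iff (x : ℝ × RevSurface)
    (v : ℝ × (ℝ × EuclideanSpace ℝ (Fin 1))) :
    (staticSpacetime r hr hpos).IsFutureCausal x v ↔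
      0 < v.1 ∧ (revMetric r hr hpos).inner x.2 v.2 v.2 ≤ v.1 ^ 2 := by
  have e1 := staticMetric_apply r hr hpos x v v
  have e2 := staticMetric_apply r hr hpos x v ((1 : ℝ), (0 : ℝ × EuclideanSpace ℝ (Fin 1)))
  have e3 : (revMetric r hr hpos).inner x.2 v.2 (0 : ℝ × EuclideanSpace ℝ (Fin 1)) = 0 :=
    map_zero _
  replace e2 : staticMetric r hr hpos x v ((1 : ℝ), (0 : ℝ × EuclideanSpace ℝ (Fin 1))) = -v.1 := by
    refine e2.trans ?_
    change -(v.1 * 1) + (revMetric r hr hpos).inner x.2 v.2 (0 : ℝ × EuclideanSpace ℝ (Fin 1)) = _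
    rw [e3]; ring
  change v ≠ 0 ∧ staticMetric r hr hpos x v v ≤ 0 ∧
    staticMetric r hr hpos x v ((1 : ℝ), (0 : ℝ × EuclideanSpace ℝ (Fin 1))) < 0 ↔ _
  constructor
  · rintro ⟨-, h1, h2⟩
    have h1' := e1.symm.trans_le h1
    have h2' := e2.symm.trans_lt h2
    exact ⟨by linarith, by rw [sq]; linarith⟩
  · rintro ⟨h1, h2⟩
    refine ⟨fun h ↦ h1.ne' (by rw [h]; rfl), e1.trans_le (by rw [sq] at h2; linarith),
      e2.trans_lt (by linarith)⟩

theorem mfderivWithin_static_fst {γ : ℝ → ℝ × RevSurface} {s : Set ℝ} {t : ℝ}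
    (hs : UniqueDiffWithinAt ℝ s t)
    (hγ : MDifferentiableWithinAt 𝓘(ℝ, ℝ) staticModel γ s t) :
    (mfderivWithin 𝓘(ℝ, ℝ) staticModel γ s t (1 : ℝ) :
      ℝ × (ℝ × EuclideanSpace ℝ (Fin 1))).1 = derivWithin (fun u ↦ (γ u).1) s t := by
  have h := mfderiv_comp_mfderivWithin t
    (mdifferentiableAt_fst (I := 𝓘(ℝ, ℝ)) (I' := revModel) (x := γ t)) hγ hs.uniqueMDiffWithinAt
  rw [mfderiv_fst] at h
  have h2 := congrArg (fun L ↦ L (1 : ℝ)) h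
  rw [← fderivWithin_derivWithin, ← mfderivWithin_eq_fderivWithin]
  exact h2.symm

theorem mfderivWithin_static_snd {γ : ℝ → ℝ × RevSurface} {s : Set ℝ} {t : ℝ}
    (hs : UniqueDiffWithinAt ℝ s t)
    (hγ : MDifferentiableWithinAt 𝓘(ℝ, ℝ) staticModel γ s t) :
    (mfderivWithin 𝓘(ℝ, ℝ) staticModel γ s t (1 : ℝ) :
      ℝ × (ℝ × EuclideanSpace ℝ (Fin 1))).2 =
      mfderivWithin 𝓘(ℝ, ℝ) revModel (fun u ↦ (γ u).2) s t (1 : ℝ) := by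
  have h := mfderiv_comp_mfderivWithin t
    (mdifferentiableAt_snd (I := 𝓘(ℝ, ℝ)) (I' := revModel) (x := γ t)) hγ hs.uniqueMDiffWithinAt
  rw [mfderiv_snd] at h
  exact (congrArg (fun L ↦ L (1 : ℝ)) h).symm

/-- Along a causal arc time increases by at least the distance of the projections. -/
theorem revDist_le_of_joinedByCausalArc {P Q : ℝ × RevSurface}
    (h : (staticSpacetime r hr hpos).JoinedByCausalArc P Q) :
    P.1 < Q.1 ∧ revDist r hr hpos P.2 Q.2 ≤ Q.1 - P.1 := by
  obtain ⟨a, b, γ, hab, rfl, rfl, hγ, hc⟩ := h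
  have hu : ∀ t ∈ Icc a b, UniqueDiffWithinAt ℝ (Icc a b) t := uniqueDiffOn_Icc hab
  have hd := hγ.mdifferentiableOn one_ne_zero
  have hc' : ∀ t ∈ Icc a b, 0 < derivWithin (fun u ↦ (γ u).1) (Icc a b) t ∧
      (revMetric r hr hpos).inner (γ t).2
        (mfderivWithin 𝓘(ℝ, ℝ) revModel (fun u ↦ (γ u).2) (Icc a b) t (1 : ℝ))
        (mfderivWithin 𝓘(ℝ, ℝ) revModel (fun u ↦ (γ u).2) (Icc a b) t (1 : ℝ)) ≤
        derivWithin (fun u ↦ (γ u).1) (Icc a b) t ^ 2 := fun t ht ↦ by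
    have := (isFutureCausal_staticSpacetime_iff r hr hpos (γ t) _).1 (hc t ht)
    rwa [mfderivWithin_static_fst (hu t ht) (hd t ht),
      mfderivWithin_static_snd (hu t ht) (hd t ht)] at this
  have hT : ContDiffOn ℝ 1 (fun u ↦ (γ u).1) (Icc a b) :=
    contMDiffOn_iff_contDiffOn.1 (contMDiff_fst.comp_contMDiffOn hγ)
  have hS : ContMDiffOn 𝓘(ℝ, ℝ) revModel 1 (fun u ↦ (γ u).2) (Icc a b) :=
    contMDiff_snd.comp_contMDiffOn hγ
  have hTd : ContinuousOn (derivWithin (fun u ↦ (γ u).1) (Icc a b)) (Icc a b) :=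
    hT.continuousOn_derivWithin (uniqueDiffOn_Icc hab) le_rfl
  have hint : ∫ t in a..b, derivWithin (fun u ↦ (γ u).1) (Icc a b) t = (γ b).1 - (γ a).1 :=
    intervalIntegral.integral_derivWithin_Icc_of_contDiffOn_Icc hT hab.le
  have hlt : 0 < ∫ t in a..b, derivWithin (fun u ↦ (γ u).1) (Icc a b) t :=
    intervalIntegral.intervalIntegral_pos_of_pos_on (hTd.intervalIntegrable_of_Icc hab.le)
      (fun t ht ↦ (hc' t (Ioo_subset_Icc_self ht)).1) hab
  refine ⟨by linarith, ?_⟩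
  have := revEDist_le_ofReal_integral r hr hpos hab.le hS hTd (fun t ht ↦ (hc' t ht).1.le)
    fun t ht ↦ (hc' t ht).2
  rw [hint] at this
  exact ENNReal.toReal_le_of_le_ofReal (by linarith) this

theorem revDist_le_of_joinedByCausalCurve {P Q : ℝ × RevSurface}
    (h : (staticSpacetime r hr hpos).JoinedByCausalCurve P Q) :
    P.1 < Q.1 ∧ revDist r hr hpos P.2 Q.2 ≤ Q.1 - P.1 := by
  induction h with
  | single h => exact revDist_le_of_joinedByCausalArc r hr hpos h
  | tail _ h ih =>
    have h' := revDist_le_of_joinedByCausalArc r hr hpos h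
    exact ⟨ih.1.trans h'.1, (revDist_triangle r hr hpos _ _ _).trans (by linarith [ih.2, h'.2])⟩

/-- With time running affinely at rate `τ - σ`, the speed bound is exactly the causality condition.
-/
theorem joinedByCausalArc_of_curve {x φ : ℝ → ℝ} (hx : ContDiff ℝ 1 x) (hφ : ContDiff ℝ 1 φ)
    (h : ∀ t ∈ Icc (0 : ℝ) 1, x t ∈ Ioo (0 : ℝ) 1) {σ τ : ℝ} (hστ : σ < τ)
    (hs : ∀ t ∈ Icc (0 : ℝ) 1, revSpeedSq r (x t) (deriv x t) (deriv φ t) ≤ (τ - σ) ^ 2) :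
    (staticSpacetime r hr hpos).JoinedByCausalArc (σ, revCurve x φ 0) (τ, revCurve x φ 1) := by
  have hu : ∀ t ∈ Icc (0 : ℝ) 1, UniqueDiffWithinAt ℝ (Icc 0 1) t := uniqueDiffOn_Icc zero_lt_one
  have hT : ContDiff ℝ 1 fun t : ℝ ↦ σ + (τ - σ) * t := by fun_prop
  have hγ : ContMDiffOn 𝓘(ℝ, ℝ) staticModel 1
      (fun t ↦ ((σ + (τ - σ) * t, revCurve x φ t) : ℝ × RevSurface)) (Icc 0 1) :=
    hT.contDiffOn.contMDiffOn.prodMk (contMDiffOn_revCurve hx.contDiffOn hφ.contDiffOn h)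
  refine ⟨0, 1, fun t ↦ (σ + (τ - σ) * t, revCurve x φ t), zero_lt_one, by simp, by simp, hγ,
    fun t ht ↦ ?_⟩
  have hd := hγ.mdifferentiableOn one_ne_zero t ht
  refine (isFutureCausal_staticSpacetime_iff r hr hpos _ _).2 ?_
  rw [mfderivWithin_static_fst (hu t ht) hd, mfderivWithin_static_snd (hu t ht) hd]
  have e : derivWithin (fun t ↦ σ + (τ - σ) * t) (Icc 0 1) t = τ - σ := by
    have h1 : HasDerivAt (fun t ↦ σ + (τ - σ) * t) (τ - σ) t := by
      simpa using ((hasDerivAt_id t).const_mul (τ - σ)).const_add σ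
    exact h1.hasDerivWithinAt.derivWithin (hu t ht)
  simp only [e]
  exact ⟨sub_pos.2 hστ, (revMetric_inner_revCurve r hr hpos ht (hu t ht) hx hφ h).trans_le (hs t ht)⟩

theorem mem_causalRelation_iff (h0 : r 0 = 0) (h1 : r 1 = 0)
    (hd0 : |deriv r 0| < 1 / (2 * Real.pi)) (hd1 : |deriv r 1| < 1 / (2 * Real.pi))
    (P Q : ℝ × RevSurface) :
    (P, Q) ∈ (staticSpacetime r hr hpos).causalRelation ↔
      revDist r hr hpos P.2 Q.2 ≤ Q.1 - P.1 := by
  constructor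
  · rintro (h | h)
    · obtain rfl : P = Q := h
      simp [revDist_self]
    · exact (revDist_le_of_joinedByCausalCurve r hr hpos h).2
  · intro h
    obtain ⟨σ, p⟩ := P
    obtain ⟨τ, q⟩ := Q
    obtain ⟨x, φ, hx, hφ, hI, rfl, rfl, hs⟩ :=
      exists_minimizing_curve r hr hpos h0 h1 hd0 hd1 p q
    have hD := revDist_nonneg r hr hpos (revCurve x φ 0) (revCurve x φ 1)
    -- If `τ = σ`, no causal curve is available; the distance is then zero, the minimizing curve has
    -- zero speed and is constant, and the two events coincide.
    rcases (hD.trans h).eq_or_lt with he | hlt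
    · left
      have hD0 : revDist r hr hpos (revCurve x φ 0) (revCurve x φ 1) = 0 :=
        le_antisymm (h.trans he.symm.le) hD
      rw [hD0] at hs
      have hz : ∀ t ∈ Icc (0 : ℝ) 1, revSpeedSq r (x t) (deriv x t) (deriv φ t) = 0 := fun t ht ↦
        le_antisymm (by simpa using hs t ht) (revSpeedSq_nonneg r _ _ _)
      have hx' : ∀ t ∈ Icc (0 : ℝ) 1, deriv x t = 0 := fun t ht ↦
        pow_eq_zero_iff two_ne_zero |>.1 (le_antisymm
          ((sq_le_revSpeedSq r _ _ _).trans (hz t ht).le) (sq_nonneg _))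
      have hφ' : ∀ t ∈ Icc (0 : ℝ) 1, deriv φ t = 0 := fun t ht ↦ by
        have h2 := hz t ht
        rw [revSpeedSq, hx' t ht] at h2
        have := (hpos _ (hI t ht)).ne'
        simpa [this] using h2
      have hconst : ∀ {f : ℝ → ℝ}, ContDiff ℝ 1 f → (∀ t ∈ Icc (0 : ℝ) 1, deriv f t = 0) →
          f 1 = f 0 := fun {f} hf hf' ↦
        constant_of_has_deriv_right_zero hf.continuous.continuousOn (fun t ht ↦ by
          have := (hf.differentiable one_ne_zero t).hasDerivAt
          rw [hf' t (Ico_subset_Icc_self ht)] at this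
          exact this.hasDerivWithinAt) 1 (right_mem_Icc.2 zero_le_one)
      have hστ : σ = τ := by simp only at he; linarith
      simp only [revCurve, hconst hx hx', hconst hφ hφ', hστ]
    · right
      simp only at h hlt
      exact Relation.TransGen.single (joinedByCausalArc_of_curve r hr hpos hx hφ hI
        (sub_pos.1 hlt) fun t ht ↦ (hs t ht).trans (pow_le_pow_left₀ hD h 2))

end Causality

end

theorem corollary4p2 (r : ℝ → ℝ) (hr : ContDiff ℝ ∞ r)
    (hpos : ∀ x ∈ Set.Ioo (0 : ℝ) 1, 0 < r x) (h0 : r 0 = 0) (h1 : r 1 = 0)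
    (hd0 : |deriv r 0| < 1 / (2 * Real.pi)) (hd1 : |deriv r 1| < 1 / (2 * Real.pi)) :
    (staticSpacetime r hr hpos).IsCausallySimple ∧
    ∀ (σ τ : ℝ) (p q : RevSurface),
      ((σ, p), (τ, q)) ∈ (staticSpacetime r hr hpos).causalRelation ↔
        ((revEDist r hr hpos p q : ENNReal) : EReal) ≤ ((τ - σ : ℝ) : EReal) := by
  have key := mem_causalRelation_iff r hr hpos h0 h1 hd0 hd1
  refine ⟨⟨fun P h ↦ lt_irrefl _ (revDist_le_of_joinedByCausalCurve r hr hpos h).1, ?_⟩,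
    fun σ τ p q ↦ ?_⟩
  · have e : (staticSpacetime r hr hpos).causalRelation =
        {x | revDist r hr hpos x.1.2 x.2.2 ≤ x.2.1 - x.1.1} := Set.ext fun x ↦ key x.1 x.2
    rw [e]
    exact isClosed_le ((continuous_revDist r hr hpos).comp
      ((continuous_snd.comp continuous_fst).prodMk (continuous_snd.comp continuous_snd)))
      ((continuous_fst.comp continuous_snd).sub (continuous_fst.comp continuous_fst))
  · rw [key, ← ofReal_revDist, EReal.coe_ennreal_ofReal, max_eq_left (revDist_nonneg r hr hpos p q),
      EReal.coe_le_coe_iff]
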